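/- All languages are subsets of $\{0,1\}^*$, and $\langle\cdot,\cdot\rangle$ is a fixed standard polynomial-time pairing of binary strings. For a language $O$, let $\mathsf{P}^{O}$ be the class of languages decided by a deterministic polynomial-time machine that may ask, in one time step, whether a string it has written belongs to $O$, and let $\mathsf{P}=\mathsf{P}^{\emptyset}$. Let $\mathsf{BPP}^{O}$ be the class of languages $L$ for which there are $R\in\mathsf{P}^{O}$ and a polynomial $m$ such that for every $x\in\{0,1\}^*$, if $r$ is uniformly distributed on $\{0,1\}^{m(|x|)}$, then $\Pr_r\big[\langle x,r\rangle\in R \Leftrightarrow x\in L\big]>2/3$. For a class $\mathcal{C}$ of languages put $\mathsf{BPP}^{\mathcal{C}}=\bigcup_{O\in\mathcal{C}}\mathsf{BPP}^{O}$. Let $\mathsf{NP}$ be the class of languages $L$ for which there are $R\in\mathsf{P}$ and a polynomial $q$ such that for all $x$: $x\in L$ if and only if there is $w$ with $|w|\le q(|x|)$ and $\langle x,w\rangle\in R$; let $\mathsf{coNP}$ be the class of the complements of languages in $\mathsf{NP}$. For a class $\mathcal{C}$ let $\mathcal{C}\mathsf{/poly}$ be the class of languages $L$ for which there are $L'\in\mathcal{C}$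 and a function $f:\mathbb{N}\to\{0,1\}^*$, with $|f(n)|$ bounded by a polynomial in $n$, such that for all $x$: $x\in L$ if and only if $\langle x,f(|x|)\rangle\in L'$. **Lemma.** $\mathsf{BPP}^{\mathsf{NP/poly}\,\cap\,\mathsf{coNP/poly}}=\mathsf{NP/poly}\cap\mathsf{coNP/poly}$. -/

import Mathlib

/-!
Complexity classes over a concrete machine model: deterministic multi-stack machines over the
alphabet `{0, 1}` with an oracle, where every elementary instruction costs one step.  A stack is one
half of a Turing machine tape, so these machines and multi-tape oracle Turing machines simulate
each other with polynomial overhead.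
-/

namespace OracleComplexity

/-- Programs of the machine.  The stacks are numbered by natural numbers, and a program mentions
only finitely many of them.
* `skip`: do nothing;
* `push b i`: push the bit `b` on stack `i`;
* `pop i`: remove the top bit of stack `i` (if there is one);
* `query i j`: ask the oracle about the string on stack `i`, push the answer bit on stack `j`;
* `seq p q`: first `p`, then `q`;
* `branch i p q r`: run `p` if stack `i` is empty, `q` if its top bit is `0`, `r` if it is `1`;
* `loop i p`: as long as stack `i` is nonempty, run `p`. -/
inductive Prog : Type
  | skip : Prog
  | push (b : Bool) (i : ℕ) : Prog
  | pop (i : ℕ) : Prog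
  | query (i j : ℕ) : Prog
  | seq (p q : Prog) : Prog
  | branch (i : ℕ) (p q r : Prog) : Prog
  | loop (i : ℕ) (p : Prog) : Prog

/-- The contents of all stacks; the top of a stack is the head of the list. -/
abbrev Store : Type := ℕ → List Bool

/-- A configuration: the list of the programs that remain to be run, and the contents of the
stacks.  (In a run of a fixed program only finitely many control lists can occur, so
this is a finite control.)  The machine has halted when the control list is empty. -/
structure Cfg : Type where
  control : List Prog
  store : Store

open Classical in
/-- One step of the machine with oracle `O`; a halted configuration does not change. -/
noncomputable def step (O : Language Bool) : Cfg → Cfg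
  | ⟨[], s⟩ => ⟨[], s⟩
  | ⟨.skip :: k, s⟩ => ⟨k, s⟩
  | ⟨.push b i :: k, s⟩ => ⟨k, Function.update s i (b :: s i)⟩
  | ⟨.pop i :: k, s⟩ => ⟨k, Function.update s i (s i).tail⟩
  | ⟨.query i j :: k, s⟩ => ⟨k, Function.update s j (decide (s i ∈ O) :: s j)⟩
  | ⟨.seq p q :: k, s⟩ => ⟨p :: q :: k, s⟩
  | ⟨.branch i p q r :: k, s⟩ =>
      match s i with
      | [] => ⟨p :: k, s⟩
      | false :: _ => ⟨q :: k, s⟩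
      | true :: _ => ⟨r :: k, s⟩
  | ⟨.loop i p :: k, s⟩ =>
      match s i with
      | [] => ⟨k, s⟩
      | _ :: _ => ⟨p :: .loop i p :: k, s⟩

/-- The initial configuration: the input `x` is on stack `0`, all other stacks are empty. -/
def initCfg (p : Prog) (x : List Bool) : Cfg :=
  ⟨[p], fun i => if i = 0 then x else []⟩

/-- A configuration is halted if nothing remains to be run. -/
def Cfg.Halted (c : Cfg) : Prop := c.control = []

/-- A halted configuration accepts if the top bit of stack `0` is `1`, otherwise it rejects. -/
def Cfg.Accepting (c : Cfg) : Prop := (c.store 0).head? = some true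

/-- The class `P^O`: the languages decided by a machine with oracle `O` that halts on every input
`x` within `t(|x|)` steps, for some polynomial `t`. -/
def PRel (O : Language Bool) : Set (Language Bool) :=
  {L | ∃ (p : Prog) (t : Polynomial ℕ), ∀ x : List Bool,
    ((step O)^[t.eval x.length] (initCfg p x)).Halted ∧
      (((step O)^[t.eval x.length] (initCfg p x)).Accepting ↔ x ∈ L)}

/-- The class `P`.  The empty language `0` as an oracle answers `0` to every query, so it is of no use. -/
def P : Set (Language Bool) := PRel 0

/-- The pairing `⟨x, y⟩` of strings: the bits of `x`, each written twice, then `01`, then `y`. -/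
def pair (x y : List Bool) : List Bool :=
  (x.flatMap fun b => [b, b]) ++ false :: true :: y

/-- The class `NP`: `x ∈ L` iff some witness `w` of length at most `q(|x|)` makes a deterministic
polynomial-time verifier accept `⟨x, w⟩`. -/
def NP : Set (Language Bool) :=
  {L | ∃ R ∈ P, ∃ q : Polynomial ℕ, ∀ x : List Bool,
    x ∈ L ↔ ∃ w : List Bool, w.length ≤ q.eval x.length ∧ pair x w ∈ R}

/-- The class `coNP` of complements of languages in `NP`. -/
def coNP : Set (Language Bool) := {L | Lᶜ ∈ NP}

/-- The class `C / F` of languages decided in `C` with an advice function from `F`. -/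
def withAdvice (C : Set (Language Bool)) (F : Set (ℕ → List Bool)) : Set (Language Bool) :=
  {L | ∃ L' ∈ C, ∃ f ∈ F, ∀ x : List Bool, x ∈ L ↔ pair x (f x.length) ∈ L'}

/-- The family `poly` of advice functions of polynomially bounded length. -/
def poly : Set (ℕ → List Bool) :=
  {f | ∃ q : Polynomial ℕ, ∀ n : ℕ, (f n).length ≤ q.eval n}

/-- The class `BPP^O`: there are a deterministic polynomial-time machine with oracle `O` (deciding
`R`) and a polynomial `m` such that for every input `x`, with probability greater than `2/3` over
`m(|x|)` independent uniform random bits `r`, the answer of the machine on `⟨x, r⟩` is correct. -/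
def BPPRel (O : Language Bool) : Set (Language Bool) :=
  {L | ∃ R ∈ PRel O, ∃ m : Polynomial ℕ, ∀ x : List Bool,
    (2 / 3 : ℝ) <
      (Nat.card {r : Fin (m.eval x.length) → Bool // pair x (List.ofFn r) ∈ R ↔ x ∈ L} : ℝ) /
        2 ^ m.eval x.length}

/-- The class `BPP^C` for a class `C` of oracles: the union of `BPP^O` over all `O ∈ C`. -/
def BPPRelClass (C : Set (Language Bool)) : Set (Language Bool) :=
  {L | ∃ O ∈ C, L ∈ BPPRel O}

end OracleComplexity

/-! Write 𝒞 for NP/poly ∩ coNP/poly. Each O in 𝒞 lies in BPP^O, because a machine can simply ask the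
oracle and ignore the random string (`mem_BPPRel_self`).

For the other inclusion let L ∈ BPP^O with O ∈ 𝒞. Since BPP^O is closed under complement, it
suffices to show L ∈ NP/poly (`mem_NP_advice_of_mem_BPPRel`). Two ideas combine. As in Adleman's
theorem, for each n there are linearly many random strings whose majority vote is right for all
inputs of length n at once (`exists_samples`, `exists_majority`); they become part of the advice.
The rest of the advice consists of the advice strings for O and for its complement, for all lengths
that a query can have. A nondeterministic machine can then do without the oracle: it guesses the
answer together with a certificate for y ∈ O or for y ∉ O, and it never halts if the check fails.
Only the correct answer has a certificate, so every halting run agrees with the true oracle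
computation (`answer_yields`). This uniqueness of the outcome, expressed by `Yields`, is preserved
by composition; it therefore extends to the whole majority vote (`vote_yields`), and rejecting
simulations can be used as safely as accepting ones.

It remains to turn a nondeterministic program into an NP language (`exists_mem_NP_of_prog`). A
deterministic verifier takes the nondeterministic choices from the witness and consumes one further
witness bit per loop iteration. The witness thus acts as fuel, and the verifier halts in linear time
on all inputs. -/

namespace OracleComplexity

open Function

/-! ### Big-step semantics, its agreement with `step`, and complements. -/

/-- Big-step semantics of programs: `Runs A p s n s'` says that `p` can run from `s` to `s'` in
exactly `n` steps, where a query about `y` may be answered by any `b` with `A y b`. -/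
inductive Runs (A : List Bool → Bool → Prop) : Prog → Store → ℕ → Store → Prop
  | skip (s) : Runs A .skip s 1 s
  | push (b i s) : Runs A (.push b i) s 1 (update s i (b :: s i))
  | pop (i s) : Runs A (.pop i) s 1 (update s i (s i).tail)
  | query (i j s b) : A (s i) b → Runs A (.query i j) s 1 (update s j (b :: s j))
  | seq {p q s s₁ s₂ m n} : Runs A p s m s₁ → Runs A q s₁ n s₂ → Runs A (.seq p q) s (m + n + 1) s₂
  | branch_nil {i p q r s s' n} : s i = [] → Runs A p s n s' → Runs A (.branch i p q r) s (n + 1) s'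
  | branch_false {i p q r s s' n l} : s i = false :: l → Runs A q s n s' →
      Runs A (.branch i p q r) s (n + 1) s'
  | branch_true {i p q r s s' n l} : s i = true :: l → Runs A r s n s' →
      Runs A (.branch i p q r) s (n + 1) s'
  | loop_nil {i p s} : s i = [] → Runs A (.loop i p) s 1 s
  | loop_cons {i p s s₁ s₂ m n} : s i ≠ [] → Runs A p s m s₁ → Runs A (.loop i p) s₁ n s₂ →
      Runs A (.loop i p) s (m + n + 1) s₂

/-- The answers of the oracle `O`. -/
def answers (O : Language Bool) (y : List Bool) (b : Bool) : Prop := b = true ↔ y ∈ O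

/-- The store with `x` on stack `0` and nothing else. -/
def initStore (x : List Bool) : Store := fun i => if i = 0 then x else []

theorem initCfg_eq (p : Prog) (x : List Bool) : initCfg p x = ⟨[p], initStore x⟩ := rfl

theorem Runs.iterate_step {O : Language Bool} {p s n s'} (h : Runs (answers O) p s n s')
    (k : List Prog) : (step O)^[n] ⟨p :: k, s⟩ = ⟨k, s'⟩ := by
  induction h generalizing k with
  | skip s => rfl
  | push b i s => rfl
  | pop i s => rfl
  | query i j s b h =>
    classical
    have : decide (s i ∈ O) = b := by
      unfold answers at h
      cases b <;> simp_all
    simp [step, this]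
  | seq h₁ h₂ ih₁ ih₂ =>
    rw [iterate_succ_apply, add_comm, iterate_add_apply]
    simp [step, ih₁, ih₂]
  | branch_nil h h₁ ih => rw [iterate_succ_apply]; simp [step, h, ih]
  | branch_false h h₁ ih => rw [iterate_succ_apply]; simp [step, h, ih]
  | branch_true h h₁ ih => rw [iterate_succ_apply]; simp [step, h, ih]
  | loop_nil h => simp [step, h]
  | @loop_cons i p s s₁ s₂ m n h h₁ h₂ ih₁ ih₂ =>
    rw [iterate_succ_apply, add_comm, iterate_add_apply]
    obtain ⟨b, l, hl⟩ := List.exists_cons_of_ne_nil h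
    simp [step, hl, ih₁, ih₂]

theorem iterate_step_halted (O : Language Bool) (s : Store) (n : ℕ) :
    (step O)^[n] ⟨[], s⟩ = ⟨[], s⟩ :=
  iterate_fixed rfl n

theorem Runs.iterate_step_of_le {O : Language Bool} {p s n s'} (h : Runs (answers O) p s n s')
    {m : ℕ} (hm : n ≤ m) : (step O)^[m] ⟨[p], s⟩ = ⟨[], s'⟩ := by
  obtain ⟨d, rfl⟩ := Nat.exists_eq_add_of_le' hm
  rw [iterate_add_apply, h.iterate_step, iterate_step_halted]

theorem Runs.unique {O : Language Bool} {p s n s' m s''} (h : Runs (answers O) p s n s')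
    (h' : Runs (answers O) p s m s'') : s' = s'' := by
  have h₁ := h.iterate_step_of_le (le_max_left n m)
  rw [h'.iterate_step_of_le (le_max_right n m)] at h₁
  exact (congrArg Cfg.store h₁).symm

/-- The induction is on the number of steps and not on the program, because unrolling a loop does
not make the program smaller. -/
theorem exists_runs_of_halted (O : Language Bool) (n : ℕ) : ∀ (p : Prog) (k : List Prog) (s : Store),
    ((step O)^[n] ⟨p :: k, s⟩).Halted → ∃ m ≤ n, ∃ s', Runs (answers O) p s m s' := by
  induction n using Nat.strong_induction_on with
  | _ n ih =>
  intro p k s h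
  cases n with
  | zero => simp [Cfg.Halted] at h
  | succ n =>
  rw [iterate_succ_apply] at h
  have two : ∀ p q k s, ((step O)^[n] ⟨p :: q :: k, s⟩).Halted →
      ∃ m₁ m₂ s₁ s₂, m₁ + m₂ + 1 ≤ n + 1 ∧ Runs (answers O) p s m₁ s₁ ∧
        Runs (answers O) q s₁ m₂ s₂ := by
    intro p q k s h
    obtain ⟨m₁, hm₁, s₁, h₁⟩ := ih n (by omega) _ _ _ h
    obtain ⟨d, rfl⟩ := Nat.exists_eq_add_of_le' hm₁
    rw [iterate_add_apply, h₁.iterate_step] at h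
    obtain ⟨m₂, hm₂, s₂, h₂⟩ := ih d (by omega) _ _ _ h
    exact ⟨m₁, m₂, s₁, s₂, by omega, h₁, h₂⟩
  cases p with
  | skip => exact ⟨1, by omega, _, .skip _⟩
  | push b i => exact ⟨1, by omega, _, .push _ _ _⟩
  | pop i => exact ⟨1, by omega, _, .pop _ _⟩
  | query i j =>
    classical
    exact ⟨1, by omega, _, .query _ _ _ (decide (s i ∈ O)) (by simp [answers])⟩
  | seq p q =>
    obtain ⟨m₁, m₂, s₁, s₂, hm, h₁, h₂⟩ := two _ _ _ _ h
    exact ⟨_, hm, _, h₁.seq h₂⟩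
  | branch i p q r =>
    rcases hl : s i with _ | ⟨_ | _, l⟩ <;> simp only [step, hl] at h <;>
      obtain ⟨m, hm, s', h'⟩ := ih n (by omega) _ _ _ h
    · exact ⟨m + 1, by omega, _, .branch_nil hl h'⟩
    · exact ⟨m + 1, by omega, _, .branch_false hl h'⟩
    · exact ⟨m + 1, by omega, _, .branch_true hl h'⟩
  | loop i p =>
    rcases hl : s i with _ | ⟨b, l⟩ <;> simp only [step, hl] at h
    · exact ⟨1, by omega, _, .loop_nil hl⟩
    · obtain ⟨m₁, m₂, s₁, s₂, hm, h₁, h₂⟩ := two _ _ _ _ h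
      exact ⟨_, hm, _, .loop_cons (by simp [hl]) h₁ h₂⟩

/-- Acceptance of a final store. -/
def Accepts (s : Store) : Prop := (s 0).head? = some true

theorem exists_runs_of_mem_PRel {O R : Language Bool} (h : R ∈ PRel O) :
    ∃ (p : Prog) (t : Polynomial ℕ), ∀ x : List Bool, ∃ n ≤ t.eval x.length, ∃ s,
      Runs (answers O) p (initStore x) n s ∧ (Accepts s ↔ x ∈ R) := by
  obtain ⟨p, t, h⟩ := h
  refine ⟨p, t, fun x => ?_⟩
  obtain ⟨h₁, h₂⟩ := h x
  obtain ⟨n, hn, s, hs⟩ := exists_runs_of_halted O _ _ _ _ h₁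
  refine ⟨n, hn, s, hs, ?_⟩
  have := hs.iterate_step_of_le hn
  rw [← h₂, initCfg, this]
  rfl

theorem mem_PRel_of_runs {O R : Language Bool} (p : Prog) (t : Polynomial ℕ)
    (h : ∀ x : List Bool, ∃ n ≤ t.eval x.length, ∃ s,
      Runs (answers O) p (initStore x) n s ∧ (Accepts s ↔ x ∈ R)) : R ∈ PRel O := by
  refine ⟨p, t, fun x => ?_⟩
  obtain ⟨n, hn, s, hs, ha⟩ := h x
  have := hs.iterate_step_of_le hn
  rw [initCfg_eq, this, ← ha]
  exact ⟨rfl, Iff.rfl⟩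

theorem compl_mem_PRel {O R : Language Bool} (h : R ∈ PRel O) : Rᶜ ∈ PRel O := by
  obtain ⟨p, t, h⟩ := exists_runs_of_mem_PRel h
  -- An empty stack `0` also means rejection, hence `true` is pushed in that case too. The 3 extra
  -- steps are one each for `seq`, `branch` and `push`.
  refine mem_PRel_of_runs (.seq p (.branch 0 (.push true 0) (.push true 0) (.push false 0)))
    (t + 3) fun x => ?_
  obtain ⟨n, hn, s, hs, ha⟩ := h x
  have key : ∃ s', Runs (answers O) (.branch 0 (.push true 0) (.push true 0) (.push false 0)) s 2 s'
      ∧ (Accepts s' ↔ ¬ Accepts s) := by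
    rcases hl : s 0 with _ | ⟨_ | _, l⟩
    · exact ⟨_, .branch_nil hl (.push _ _ _), by simp [Accepts, hl]⟩
    · exact ⟨_, .branch_false hl (.push _ _ _), by simp [Accepts, hl]⟩
    · exact ⟨_, .branch_true hl (.push _ _ _), by simp [Accepts, hl]⟩
  obtain ⟨s', hs', ha'⟩ := key
  refine ⟨_, ?_, s', hs.seq hs', ?_⟩
  · simp; omega
  · rw [ha', ha]; rfl

theorem compl_mem_BPPRel {O L : Language Bool} (h : L ∈ BPPRel O) : Lᶜ ∈ BPPRel O := by
  obtain ⟨R, hR, m, h⟩ := h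
  refine ⟨Rᶜ, compl_mem_PRel hR, m, fun x => ?_⟩
  have e : ∀ r : Fin (m.eval x.length) → Bool,
      (pair x (List.ofFn r) ∈ Rᶜ ↔ x ∈ Lᶜ) ↔ (pair x (List.ofFn r) ∈ R ↔ x ∈ L) :=
    fun r => not_iff_not
  simp only [e]
  exact h x

/-- This bounds the length of every query by the input length plus the running time. -/
theorem Runs.length_le {A p s n s'} (h : Runs A p s n s') (k : ℕ) :
    (s' k).length ≤ (s k).length + n := by
  induction h with
  | skip s => omega
  | push b i s => by_cases hk : k = i <;> simp [hk]
  | pop i s => by_cases hk : k = i <;> simp [hk]; omega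
  | query i j s b h => by_cases hk : k = j <;> simp [hk]
  | loop_nil h => omega
  | _ => omega

/-- A number above all stacks that a program mentions. -/
def stackBound : Prog → ℕ
  | .skip => 0
  | .push _ i => i + 1
  | .pop i => i + 1
  | .query i j => max (i + 1) (j + 1)
  | .seq p q => max (stackBound p) (stackBound q)
  | .branch i p q r => max (i + 1) (max (stackBound p) (max (stackBound q) (stackBound r)))
  | .loop i p => max (i + 1) (stackBound p)

/-- Consequently only finitely many stacks have to be cleared before a simulated program is run
again. -/
theorem Runs.eq_of_stackBound_le {A p s n s'} (h : Runs A p s n s') {k : ℕ}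
    (hk : stackBound p ≤ k) : s' k = s k := by
  induction h with
  | skip s => rfl
  | push b i s => simp [stackBound] at hk; rw [update_of_ne (by omega)]
  | pop i s => simp [stackBound] at hk; rw [update_of_ne (by omega)]
  | query i j s b h => simp [stackBound] at hk; rw [update_of_ne (by omega)]
  | loop_nil h => rfl
  | seq h₁ h₂ ih₁ ih₂ => simp [stackBound] at hk; rw [ih₂ hk.2, ih₁ hk.1]
  | loop_cons h h₁ h₂ ih₁ ih₂ => rw [ih₂ hk, ih₁ (by simp [stackBound] at hk; omega)]
  | _ h₀ h₁ ih => simp [stackBound] at hk; exact ih (by omega)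

/-! ### Nondeterministic programs with a single possible outcome. -/

/-- `p`, started in `s`, can halt within `c` steps, and `s'` is its only possible outcome. -/
structure Yields (A : List Bool → Bool → Prop) (p : Prog) (s : Store) (c : ℕ) (s' : Store) :
    Prop where
  exists_le : ∃ n ≤ c, Runs A p s n s'
  unique : ∀ n s'', Runs A p s n s'' → s'' = s'

namespace Yields

variable {A : List Bool → Bool → Prop} {p q r : Prog} {s s' s₁ s₂ : Store} {c d i : ℕ}

theorem mono (h : Yields A p s c s') (hc : c ≤ d) : Yields A p s d s' :=
  ⟨let ⟨n, hn, hr⟩ := h.1; ⟨n, hn.trans hc, hr⟩, h.2⟩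

theorem congr (h : Yields A p s c s₁) (hs : s₁ = s₂) (hc : c ≤ d) : Yields A p s d s₂ :=
  hs ▸ h.mono hc

theorem skip (s : Store) : Yields A .skip s 1 s :=
  ⟨⟨1, le_rfl, .skip s⟩, fun _ _ h => by cases h; rfl⟩

theorem push (b : Bool) (i : ℕ) (s : Store) :
    Yields A (.push b i) s 1 (update s i (b :: s i)) :=
  ⟨⟨1, le_rfl, .push b i s⟩, fun _ _ h => by cases h; rfl⟩

theorem pop (i : ℕ) (s : Store) : Yields A (.pop i) s 1 (update s i (s i).tail) :=
  ⟨⟨1, le_rfl, .pop i s⟩, fun _ _ h => by cases h; rfl⟩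

theorem seq (h₁ : Yields A p s c s₁) (h₂ : Yields A q s₁ d s₂) :
    Yields A (.seq p q) s (c + d + 1) s₂ := by
  obtain ⟨n₁, hn₁, r₁⟩ := h₁.1
  obtain ⟨n₂, hn₂, r₂⟩ := h₂.1
  refine ⟨⟨_, by omega, r₁.seq r₂⟩, fun n s'' h => ?_⟩
  cases h with
  | seq a b =>
    cases h₁.2 _ _ a
    exact h₂.2 _ _ b

theorem branch_nil (hl : s i = []) (h : Yields A p s c s') :
    Yields A (.branch i p q r) s (c + 1) s' := by
  obtain ⟨n, hn, hr⟩ := h.1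
  refine ⟨⟨_, by omega, .branch_nil hl hr⟩, fun n s'' h' => ?_⟩
  cases h' <;> simp_all
  exact h.2 _ _ ‹_›

theorem branch_false {l : List Bool} (hl : s i = false :: l) (h : Yields A q s c s') :
    Yields A (.branch i p q r) s (c + 1) s' := by
  obtain ⟨n, hn, hr⟩ := h.1
  refine ⟨⟨_, by omega, .branch_false hl hr⟩, fun n s'' h' => ?_⟩
  cases h' <;> simp_all
  exact h.2 _ _ ‹_›

theorem branch_true {l : List Bool} (hl : s i = true :: l) (h : Yields A r s c s') :
    Yields A (.branch i p q r) s (c + 1) s' := by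
  obtain ⟨n, hn, hr⟩ := h.1
  refine ⟨⟨_, by omega, .branch_true hl hr⟩, fun n s'' h' => ?_⟩
  cases h' <;> simp_all
  exact h.2 _ _ ‹_›

theorem loop_nil (hl : s i = []) : Yields A (.loop i p) s 1 s := by
  refine ⟨⟨_, le_rfl, .loop_nil hl⟩, fun n s'' h' => ?_⟩
  cases h' with
  | loop_nil => rfl
  | loop_cons h => exact absurd hl h

theorem loop_cons (hl : s i ≠ []) (h₁ : Yields A p s c s₁) (h₂ : Yields A (.loop i p) s₁ d s₂) :
    Yields A (.loop i p) s (c + d + 1) s₂ := by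
  obtain ⟨n₁, hn₁, r₁⟩ := h₁.1
  obtain ⟨n₂, hn₂, r₂⟩ := h₂.1
  refine ⟨⟨_, by omega, .loop_cons hl r₁ r₂⟩, fun n s'' h => ?_⟩
  cases h with
  | loop_nil h => exact absurd h hl
  | loop_cons _ a b =>
    cases h₁.2 _ _ a
    exact h₂.2 _ _ b

end Yields

infixr:60 " ;; " => Prog.seq

/-! ### Moving, copying and decoding strings on stacks. -/

/-- Push the bit `b` on all stacks in a list. -/
def pushAll (b : Bool) : List ℕ → Prog
  | [] => .skip
  | j :: js => .push b j ;; pushAll b js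

/-- Empty the stack `i` and push each of its bits on all stacks in a list. -/
def transfer (i : ℕ) (js : List ℕ) : Prog :=
  .loop i (.branch i .skip (.pop i ;; pushAll false js) (.pop i ;; pushAll true js))

theorem pushAll_yields {A} (b : Bool) (js : List ℕ) (s : Store) :
    Yields A (pushAll b js) s (2 * js.length + 1) fun k => List.replicate (js.count k) b ++ s k := by
  induction js generalizing s with
  | nil => simpa [pushAll] using Yields.skip s
  | cons j js ih =>
    refine ((Yields.push b j s).seq (ih _)).congr ?_ (by simp; omega)
    funext k
    by_cases hk : k = j
    · subst hk
      simp [List.replicate_succ']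
    · simp [hk, List.count_cons_of_ne (Ne.symm hk)]

/-- Bits are popped from the top and land on top of each other, which reverses the string. A target
listed several times receives every bit that often; this is how strings get doubled for `pair`. -/
theorem transfer_yields {A} (i : ℕ) (js : List ℕ) (hi : i ∉ js) (s : Store) :
    Yields A (transfer i js) s ((s i).length * (2 * js.length + 5) + 1) fun k =>
      if k = i then [] else ((s i).reverse.flatMap fun b => List.replicate (js.count k) b) ++ s k := by
  generalize hl : s i = l
  induction l generalizing s with
  | nil => refine (Yields.loop_nil hl).congr ?_ (by simp)
           funext k
           by_cases hk : k = i <;> simp [hk, hl]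
  | cons b l ih =>
    have body : Yields A (.branch i .skip (.pop i ;; pushAll false js) (.pop i ;; pushAll true js))
        s (2 * js.length + 4) fun k => List.replicate (js.count k) b ++ update s i l k := by
      have := (Yields.pop (A := A) i s).seq (pushAll_yields b js _)
      simp only [hl, List.tail_cons] at this
      cases b
      · exact (this.branch_false hl).mono (by omega)
      · exact (this.branch_true hl).mono (by omega)
    refine (body.loop_cons (by simp [hl]) (ih _ ?_)).congr ?_ ?_
    · simp [List.count_eq_zero_of_not_mem hi]
    · funext k
      by_cases hk : k = i <;> simp [hk]
    · simp only [List.length_cons]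
      ring_nf
      omega

theorem clear_yields {A} (i : ℕ) (s : Store) :
    Yields A (transfer i []) s ((s i).length * 5 + 1) (update s i []) := by
  refine (transfer_yields i [] (by simp) s).congr ?_ (by simp)
  funext k
  by_cases hk : k = i <;> simp [hk]

theorem move_yields {A} {i j : ℕ} (h : i ≠ j) (s : Store) :
    Yields A (transfer i [j]) s ((s i).length * 7 + 1)
      (update (update s i []) j ((s i).reverse ++ s j)) := by
  refine (transfer_yields i [j] (by simp [h]) s).congr ?_ (by simp)
  funext k
  by_cases hk : k = i
  · subst hk; simp [h]
  · by_cases hj : k = j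
    · subst hj; simp [hk]
    · simp [hk, hj, Ne.symm hj]

/-- Every bit of a string is written twice. -/
def double (l : List Bool) : List Bool := l.flatMap fun b => [b, b]

theorem pair_eq (x y : List Bool) : pair x y = double x ++ false :: true :: y := rfl

theorem double_append (x y : List Bool) : double (x ++ y) = double x ++ double y := by
  simp [double]

theorem length_double (x : List Bool) : (double x).length = 2 * x.length := by
  induction x with
  | nil => rfl
  | cons b x ih => simp [double] at ih ⊢; omega

theorem length_pair (x y : List Bool) : (pair x y).length = 2 * x.length + y.length + 2 := by
  simp [pair_eq, length_double]; omega

theorem move_double_yields {A} {i j : ℕ} (h : i ≠ j) (s : Store) :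
    Yields A (transfer i [j, j]) s ((s i).length * 9 + 1)
      (update (update s i []) j (double (s i).reverse ++ s j)) := by
  refine (transfer_yields i [j, j] (by simp [h]) s).congr ?_ (by simp)
  funext k
  by_cases hk : k = i
  · subst hk; simp [h]
  · by_cases hj : k = j
    · subst hj; simp [hk, double, List.replicate]
    · simp [hk, hj, Ne.symm hj]

/-- In `pair (pair y f) w` the bits of `y` are doubled twice. -/
theorem move_quadruple_yields {A} {i j : ℕ} (h : i ≠ j) (s : Store) :
    Yields A (transfer i [j, j, j, j]) s ((s i).length * 13 + 1)
      (update (update s i []) j (double (double (s i).reverse) ++ s j)) := by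
  refine (transfer_yields i [j, j, j, j] (by simp [h]) s).congr ?_ (by simp)
  funext k
  by_cases hk : k = i
  · subst hk; simp [h]
  · by_cases hj : k = j
    · subst hj; simp [hk, double, List.replicate, List.flatMap_assoc]
    · simp [hk, hj, Ne.symm hj]

theorem flatMap_nil (l : List Bool) : (l.flatMap fun _ => ([] : List Bool)) = [] := by
  induction l <;> simp_all

/-- Push the reverse of the stack `i` on the stack `j`, using the empty stack `t`. -/
def copyReverse (i j t : ℕ) : Prog := transfer i [t, j] ;; transfer t [i]

theorem copyReverse_yields {A} {i j t : ℕ} (hij : i ≠ j) (hit : i ≠ t) (hjt : j ≠ t) (s : Store)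
    (ht : s t = []) :
    Yields A (copyReverse i j t) s ((s i).length * 16 + 3) (update s j ((s i).reverse ++ s j)) := by
  refine ((transfer_yields i [t, j] (by simp [hij, hit]) s).seq
    (transfer_yields t [i] (by simp [hit.symm]) _)).congr ?_ ?_
  · funext k
    by_cases hk : k = t
    · subst hk; simp [hjt.symm, ht]
    · by_cases hi : k = i
      · subst hi; simp [hk, hij, hit.symm, ht, hjt]
      · by_cases hj : k = j
        · subst hj; simp [hi, hk, Ne.symm hi, Ne.symm hk]
        · simp [hi, hj, hk, Ne.symm hi, Ne.symm hj, Ne.symm hk, flatMap_nil]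
  · simp [hit.symm, ht, hjt]; omega

/-- The decoding of `pair`; on other strings, whatever `readField` makes of them. -/
def split : List Bool → List Bool × List Bool
  | [] => ([], [])
  | [_] => ([], [])
  | false :: true :: l => ([], l)
  | false :: false :: l => (false :: (split l).1, (split l).2)
  | true :: _ :: l => (true :: (split l).1, (split l).2)

@[simp] theorem split_pair (x y : List Bool) : split (pair x y) = (x, y) := by
  induction x with
  | nil => rfl
  | cons b x ih =>
    rw [pair_eq] at ih
    cases b <;> simp_all [pair_eq, double, split]

theorem length_split (l : List Bool) : (split l).1.length + (split l).2.length ≤ l.length := by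
  fun_induction split l <;> simp <;> omega

/-- Remove the encoding of a string from the stack `i` and push the reverse of that string on the
stack `j`; the stack `c` holds a flag. -/
def readField (i j c : ℕ) : Prog :=
  .push true c ;; .loop c (.branch i (.pop c)
    (.pop i ;; .branch i (.pop c) (.pop i ;; .push false j) (.pop i ;; .pop c))
    (.pop i ;; .branch i (.pop c) (.pop i ;; .push true j) (.pop i ;; .push true j)))

/-- A loop can only test a stack for emptiness, so the end of the field is signalled by emptying the
flag stack `c`. The induction follows the recursion of `split` and so covers malformed strings too,
on which a polynomial-time machine also has to halt. -/
theorem readField_yields {A} {i j c : ℕ} (hij : i ≠ j) (hic : i ≠ c) (hjc : j ≠ c) (s : Store)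
    (hc : s c = []) :
    Yields A (readField i j c) s (10 * (s i).length + 20)
      (update (update s i (split (s i)).2) j ((split (s i)).1.reverse ++ s j)) := by
  have key : ∀ (l : List Bool) (s : Store), s c = [true] → s i = l →
      Yields A (.loop c (.branch i (.pop c)
        (.pop i ;; .branch i (.pop c) (.pop i ;; .push false j) (.pop i ;; .pop c))
        (.pop i ;; .branch i (.pop c) (.pop i ;; .push true j) (.pop i ;; .push true j))))
        s (10 * l.length + 10)
        (update (update (update s c []) i (split l).2) j ((split l).1.reverse ++ s j)) := by
    intro l
    fun_induction split l with
    | case1 =>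
      intro s hc hl
      refine (((Yields.pop c s).branch_nil hl).loop_cons (by simp [hc])
        (Yields.loop_nil (by simp [hc]))).congr ?_ (by simp)
      funext k
      simp only [update_apply]
      split_ifs <;> simp_all
    | case2 b =>
      intro s hc hl
      have h (q r) := (Yields.pop (A := A) i s).seq
        ((Yields.pop c _).branch_nil (q := q) (r := r) (i := i) (by simp [hl]))
      have e : update (update s i (s i).tail) c (update s i (s i).tail c).tail c = [] := by
        simp [hic.symm, hc]
      cases b
      · refine (((h _ _).branch_false hl).loop_cons (by simp [hc]) (.loop_nil e)).congr ?_ (by simp)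
        funext k
        simp only [update_apply]
        split_ifs <;> simp_all
      · refine (((h _ _).branch_true hl).loop_cons (by simp [hc]) (.loop_nil e)).congr ?_ (by simp)
        funext k
        simp only [update_apply]
        split_ifs <;> simp_all
    | case3 l =>
      intro s hc hl
      have h := (Yields.pop (A := A) i s).seq
        (((Yields.pop i _).seq (Yields.pop c _)).branch_true (p := .pop c)
          (q := .pop i ;; .push false j) (i := i) (l := l) (by simp [hl]))
      refine ((h.branch_false hl).loop_cons (by simp [hc])
        (Yields.loop_nil (by simp [hc, hic.symm]))).congr ?_ (by simp)
      funext k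
      simp only [update_apply]
      split_ifs <;> simp_all
    | case4 l ih =>
      intro s hc hl
      have h := (Yields.pop (A := A) i s).seq
        (((Yields.pop i _).seq (Yields.push false j _)).branch_false (p := .pop c)
          (r := .pop i ;; .pop c) (i := i) (l := l) (by simp [hl]))
      refine ((h.branch_false hl).loop_cons (by simp [hc])
        (ih _ (by simp [hc, hic.symm, hjc.symm]) (by simp [hl, hij]))).congr ?_ (by simp; omega)
      funext k
      simp only [update_apply]
      split_ifs <;> simp_all
    | case5 b l ih =>
      intro s hc hl
      have h : Yields A (.pop i ;; .branch i (.pop c) (.pop i ;; .push true j)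
          (.pop i ;; .push true j)) s 6 (update (update s i l) j (true :: s j)) := by
        have := (Yields.pop (A := A) i (update s i (b :: l))).seq (Yields.push true j _)
        have e : update s i (s i).tail = update s i (b :: l) := by simp [hl]
        have h₁ : Yields A (.branch i (.pop c) (.pop i ;; .push true j) (.pop i ;; .push true j))
            (update s i (s i).tail) 4 (update (update s i l) j (true :: s j)) := by
          rw [e]
          simp [hij.symm] at this
          cases b
          · exact this.branch_false (l := l) (by simp)
          · exact this.branch_true (l := l) (by simp)
        exact (Yields.pop i s).seq h₁
      refine ((h.branch_true hl).loop_cons (by simp [hc])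
        (ih _ (by simp [hc, hic.symm, hjc.symm]) (by simp [hij]))).congr ?_ (by simp; omega)
      funext k
      simp only [update_apply]
      split_ifs <;> simp_all
  refine ((Yields.push true c s).seq (key (s i) _ (by simp [hc]) (by simp [hic]))).congr ?_
    (by omega)
  funext k
  simp only [update_apply]
  split_ifs <;> simp_all

/-! ### Every oracle belongs to its own BPP class. -/

/-- The strings whose first component belongs to `O`. -/
def firstIn (O : Language Bool) : Language Bool := fun z => (split z).1 ∈ O

theorem firstIn_mem_PRel (O : Language Bool) : firstIn O ∈ PRel O := by
  classical
  refine mem_PRel_of_runs (readField 0 1 2 ;; transfer 1 [3] ;; .query 3 0)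
    (20 * Polynomial.X + 30) fun z => ?_
  have h₁ := readField_yields (A := answers O) (i := 0) (j := 1) (c := 2) (by simp)
    (by simp) (by simp) (initStore z) rfl
  have h₂ := move_yields (A := answers O) (i := 1) (j := 3) (by simp)
    (update (update (initStore z) 0 (split z).2) 1 (split z).1.reverse)
  have e := length_split z
  obtain ⟨n, hn, h⟩ := (h₁.congr (s₂ := update (update (initStore z) 0 (split z).2) 1
    (split z).1.reverse) (by simp [initStore]) le_rfl).1
  obtain ⟨m, hm, h'⟩ := h₂.1
  refine ⟨_, ?_, _, h.seq (h'.seq (.query _ _ _ (decide ((split z).1 ∈ O)) ?_)), ?_⟩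
  · simp [initStore] at hn hm ⊢
    omega
  · simp [answers, initStore]
  · simp [Accepts]; rfl

theorem mem_BPPRel_self (O : Language Bool) : O ∈ BPPRel O := by
  -- With `m = 0` there is a single, empty random string, and the answer is correct with probability
  -- 1.
  refine ⟨_, firstIn_mem_PRel O, 0, fun x => ?_⟩
  have : ∀ r : Fin ((0 : Polynomial ℕ).eval x.length) → Bool,
      (pair x (List.ofFn r) ∈ firstIn O ↔ x ∈ O) := by
    intro r
    change (split (pair x (List.ofFn r))).1 ∈ O ↔ x ∈ O
    rw [split_pair]
  simp only [this]
  simp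
  norm_num

/-! ### Nondeterministic programs define NP languages. -/

/-- The oracle relation of a nondeterministic machine: every answer is possible. -/
def guesses (_ : List Bool) (_ : Bool) : Prop := True

/-- Put `S` on stack `0` and move all other stacks up by one. -/
def scons (S : List Bool) (t : Store) : Store
  | 0 => S
  | k + 1 => t k

@[simp] theorem scons_zero (S t) : scons S t 0 = S := rfl
@[simp] theorem scons_succ (S t k) : scons S t (k + 1) = t k := rfl

@[simp] theorem update_scons_zero (S t l) : update (scons S t) 0 l = scons l t := by
  funext k
  cases k <;> simp

@[simp] theorem update_scons_succ (S t l i) :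
    update (scons S t) (i + 1) l = scons S (update t i l) := by
  funext k
  cases k with
  | zero => simp
  | succ k => by_cases h : k = i <;> simp [h]

/-- Deterministic simulation of a nondeterministic program: stack `0` provides the guesses, and each
loop iteration consumes one bit of it.  Once stack `0` is empty, the loops are left. -/
def clocked : Prog → Prog
  | .skip => .skip
  | .push b i => .push b (i + 1)
  | .pop i => .pop (i + 1)
  | .query _ j => .branch 0 .skip (.pop 0 ;; .push false (j + 1)) (.pop 0 ;; .push true (j + 1))
  | .seq p q => clocked p ;; clocked q
  | .branch i p q r => .branch (i + 1) (clocked p) (clocked q) (clocked r)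
  | .loop i p => .loop (i + 1) (clocked p ;; .branch 0 (transfer (i + 1) []) (.pop 0) (.pop 0))

/-- The total length of the first `N` stacks. -/
def size (N : ℕ) (t : Store) : ℕ := ∑ i ∈ Finset.range N, (t i).length

theorem size_update {N i : ℕ} (hi : i < N) (t : Store) (l : List Bool) :
    size N (update t i l) + (t i).length = size N t + l.length := by
  unfold size
  have hi' := Finset.mem_range.2 hi
  rw [← Finset.add_sum_erase _ _ hi', ← Finset.add_sum_erase _ (fun i => (t i).length) hi',
    Finset.sum_congr rfl fun k hk => by rw [update_of_ne (Finset.ne_of_mem_erase hk)]]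
  simp
  omega

theorem runs_pop_zero {A} (b : Bool) (S : List Bool) (t : Store) :
    Runs A (.pop 0) (scons (b :: S) t) 1 (scons S t) := by
  simpa using Runs.pop (A := A) 0 (scons (b :: S) t)

theorem runs_push_succ {A} (b : Bool) (i : ℕ) (S : List Bool) (t : Store) :
    Runs A (.push b (i + 1)) (scons S t) 1 (scons S (update t i (b :: t i))) := by
  simpa using Runs.push (A := A) b (i + 1) (scons S t)

theorem runs_branch_pop {A p} (b : Bool) (S : List Bool) (t : Store) :
    Runs A (.branch 0 p (.pop 0) (.pop 0)) (scons (b :: S) t) 2 (scons S t) := by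
  cases b
  · exact .branch_false rfl (runs_pop_zero _ _ _)
  · exact .branch_true rfl (runs_pop_zero _ _ _)

theorem runs_clocked_query {A i j} (b : Bool) (S : List Bool) (t : Store) :
    Runs A (clocked (.query i j)) (scons (b :: S) t) 4 (scons S (update t j (b :: t j))) := by
  cases b
  · exact .branch_false rfl ((runs_pop_zero _ _ _).seq (runs_push_succ _ _ _ _))
  · exact .branch_true rfl ((runs_pop_zero _ _ _).seq (runs_push_succ _ _ _ _))

/-- An amortized count: every bit of fuel pays `c` steps and every stored bit pays 5, the price of
removing it with `transfer`. Hence the time is linear whatever the fuel contains. If fuel is left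
over, no loop was cut short and no query went unanswered, so the run is a faithful one of `p`. -/
theorem exists_runs_clocked (A : List Bool → Bool → Prop) (p : Prog) :
    ∃ c, ∀ N, stackBound p ≤ N → ∀ S t, ∃ n S' t', Runs A (clocked p) (scons S t) n (scons S' t') ∧
      S'.length ≤ S.length ∧ n + 5 * size N t' + c * S'.length ≤ 5 * size N t + c * S.length + c ∧
      (S' ≠ [] → ∃ m, Runs guesses p t m t') := by
  induction p with
  | skip =>
    exact ⟨1, fun N _ S t => ⟨1, S, t, .skip _, le_rfl, by omega, fun _ => ⟨1, .skip _⟩⟩⟩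
  | push b i =>
    -- One step, and 5 units of potential for the new bit.
    refine ⟨6, fun N hN S t => ⟨1, S, _, runs_push_succ b i S t, le_rfl, ?_, fun _ => ⟨1, .push _ _ _⟩⟩⟩
    have := size_update (show i < N from hN) t (b :: t i)
    simp at this
    omega
  | pop i =>
    refine ⟨1, fun N hN S t => ⟨1, S, update t i (t i).tail, ?_, le_rfl, ?_, fun _ => ⟨1, .pop _ _⟩⟩⟩
    · simpa [clocked] using Runs.pop (A := A) (i + 1) (scons S t)
    · have := size_update (show i < N from hN) t (t i).tail
      simp at this
      omega
  | query i j =>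
    refine ⟨10, fun N hN S t => ?_⟩
    cases S with
    | nil => exact ⟨2, [], t, .branch_nil rfl (.skip _), le_rfl, by omega, by simp⟩
    | cons b S =>
      refine ⟨4, S, _, runs_clocked_query b S t, by simp, ?_, fun _ => ⟨1, .query _ _ _ _ trivial⟩⟩
      have := size_update (show j < N by simp [stackBound] at hN; omega) t (b :: t j)
      simp at this ⊢
      omega
  | seq p q ihp ihq =>
    obtain ⟨c, hc⟩ := ihp
    obtain ⟨d, hd⟩ := ihq
    refine ⟨c + d + 1, fun N hN S t => ?_⟩
    simp only [stackBound, max_le_iff] at hN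
    obtain ⟨n, S₁, t₁, h₁, hS₁, ht₁, hr₁⟩ := hc N hN.1 S t
    obtain ⟨m, S₂, t₂, h₂, hS₂, ht₂, hr₂⟩ := hd N hN.2 S₁ t₁
    refine ⟨_, S₂, t₂, h₁.seq h₂, by omega, ?_, fun h => ?_⟩
    · obtain ⟨a, ha⟩ := Nat.exists_eq_add_of_le hS₁
      obtain ⟨b, hb⟩ := Nat.exists_eq_add_of_le hS₂
      rw [ha, hb] at ht₁ ⊢
      rw [hb] at ht₂
      nlinarith
    · obtain ⟨m₂, k₂⟩ := hr₂ h
      obtain ⟨m₁, k₁⟩ := hr₁ (by rintro rfl; simp_all)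
      exact ⟨_, k₁.seq k₂⟩
  | branch i p q r ihp ihq ihr =>
    obtain ⟨c, hc⟩ := ihp
    obtain ⟨d, hd⟩ := ihq
    obtain ⟨e, he⟩ := ihr
    refine ⟨c + d + e + 1, fun N hN S t => ?_⟩
    simp only [stackBound, max_le_iff] at hN
    rcases hl : t i with _ | ⟨_ | _, l⟩
    · obtain ⟨n, S₁, t₁, h₁, hS₁, ht₁, hr₁⟩ := hc N hN.2.1 S t
      refine ⟨_, S₁, t₁, .branch_nil hl h₁, hS₁, ?_, fun h => ?_⟩
      · nlinarith
      · obtain ⟨m, k⟩ := hr₁ h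
        exact ⟨_, .branch_nil hl k⟩
    · obtain ⟨n, S₁, t₁, h₁, hS₁, ht₁, hr₁⟩ := hd N hN.2.2.1 S t
      refine ⟨_, S₁, t₁, .branch_false hl h₁, hS₁, ?_, fun h => ?_⟩
      · nlinarith
      · obtain ⟨m, k⟩ := hr₁ h
        exact ⟨_, .branch_false hl k⟩
    · obtain ⟨n, S₁, t₁, h₁, hS₁, ht₁, hr₁⟩ := he N hN.2.2.2 S t
      refine ⟨_, S₁, t₁, .branch_true hl h₁, hS₁, ?_, fun h => ?_⟩
      · nlinarith
      · obtain ⟨m, k⟩ := hr₁ h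
        exact ⟨_, .branch_true hl k⟩
  | loop i p ih =>
    obtain ⟨c, hc⟩ := ih
    refine ⟨c + 10, fun N hN S t => ?_⟩
    simp only [stackBound, max_le_iff] at hN
    generalize hk : S.length = k
    -- Each iteration that does not end the loop uses up at least one bit of fuel.
    induction k using Nat.strong_induction_on generalizing S t with
    | _ k ihk =>
    subst hk
    by_cases hl : t i = []
    · exact ⟨1, S, t, .loop_nil hl, le_rfl, by nlinarith, fun _ => ⟨1, .loop_nil hl⟩⟩
    obtain ⟨n, S₁, t₁, h₁, hS₁, ht₁, hr₁⟩ := hc N hN.2 S t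
    cases S₁ with
    -- The fuel ran out inside the body. The loop is forced to end by clearing its stack, paid for
    -- by the potential of that stack; nothing is claimed about `p` in this case.
    | nil =>
      obtain ⟨m, hm, hc'⟩ := (clear_yields (A := A) (i + 1) (scons [] t₁)).1
      simp only [update_scons_succ, scons_succ] at hc' hm
      refine ⟨_, [], _, .loop_cons hl (h₁.seq (.branch_nil rfl hc')) (.loop_nil (by simp)),
        by simp, ?_, by simp⟩
      have := size_update (show i < N by omega) t₁ []
      simp at this ht₁ ⊢
      nlinarith
    | cons b S₁ =>
      simp only [List.length_cons] at hS₁ ht₁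
      obtain ⟨m, S₂, t₂, h₂, hS₂, ht₂, hr₂⟩ := ihk S₁.length (by omega) S₁ t₁ rfl
      refine ⟨_, S₂, t₂, .loop_cons hl (h₁.seq (runs_branch_pop b S₁ t₁)) h₂, by omega, ?_,
        fun h => ?_⟩
      · obtain ⟨a, ha⟩ := Nat.exists_eq_add_of_le hS₁
        rw [ha] at ht₁ ⊢
        nlinarith
      · obtain ⟨m₁, k₁⟩ := hr₁ (by simp)
        obtain ⟨m₂, k₂⟩ := hr₂ h
        exact ⟨_, .loop_cons hl k₁ k₂⟩

/-- The fuel `u` lists the oracle answers in order, with a bit `true` inserted for each loop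
iteration. Queries and iterations cost at least one step each, hence `u.length ≤ n`. -/
theorem Runs.exists_clocked (A : List Bool → Bool → Prop) {p t n t'} (h : Runs guesses p t n t') :
    ∃ u : List Bool, u.length ≤ n ∧ ∀ S, S ≠ [] →
      ∃ m, Runs A (clocked p) (scons (u ++ S) t) m (scons S t') := by
  induction h with
  | skip s => exact ⟨[], by simp, fun S _ => ⟨1, .skip _⟩⟩
  | push b i s => exact ⟨[], by simp, fun S _ => ⟨1, runs_push_succ _ _ _ _⟩⟩
  | pop i s => exact ⟨[], by simp, fun S _ => ⟨1, by
      simpa [clocked] using Runs.pop (A := A) (i + 1) (scons S s)⟩⟩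
  | query i j s b h => exact ⟨[b], by simp, fun S _ => ⟨4, runs_clocked_query _ _ _⟩⟩
  | seq h₁ h₂ ih₁ ih₂ =>
    obtain ⟨u, hu, r⟩ := ih₁
    obtain ⟨v, hv, r'⟩ := ih₂
    refine ⟨u ++ v, by simp; omega, fun S hS => ?_⟩
    obtain ⟨m, k⟩ := r (v ++ S) (by simp [hS])
    obtain ⟨m', k'⟩ := r' S hS
    exact ⟨_, .seq (by rwa [List.append_assoc]) k'⟩
  | branch_nil h h₁ ih =>
    obtain ⟨u, hu, r⟩ := ih
    exact ⟨u, by omega, fun S hS => let ⟨_, k⟩ := r S hS; ⟨_, .branch_nil h k⟩⟩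
  | branch_false h h₁ ih =>
    obtain ⟨u, hu, r⟩ := ih
    exact ⟨u, by omega, fun S hS => let ⟨_, k⟩ := r S hS; ⟨_, .branch_false h k⟩⟩
  | branch_true h h₁ ih =>
    obtain ⟨u, hu, r⟩ := ih
    exact ⟨u, by omega, fun S hS => let ⟨_, k⟩ := r S hS; ⟨_, .branch_true h k⟩⟩
  | loop_nil h => exact ⟨[], by simp, fun S _ => ⟨1, .loop_nil h⟩⟩
  | loop_cons h h₁ h₂ ih₁ ih₂ =>
    obtain ⟨u, hu, r⟩ := ih₁
    obtain ⟨v, hv, r'⟩ := ih₂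
    refine ⟨u ++ true :: v, by simp; omega, fun S hS => ?_⟩
    obtain ⟨m, k⟩ := r (true :: v ++ S) (by simp)
    obtain ⟨m', k'⟩ := r' S hS
    exact ⟨_, .loop_cons h (Runs.seq (by rwa [List.append_assoc]) (runs_branch_pop true _ _)) k'⟩

/-- The deterministic verifier that a nondeterministic program gives rise to. -/
def verifier (p : Prog) : Prog :=
  readField 0 2 3 ;; transfer 2 [1] ;; clocked p ;;
    .branch 0 .skip (.branch 1 (.push false 0) (.push false 0) (.push true 0))
      (.branch 1 (.push false 0) (.push false 0) (.push true 0))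

/-- The witness stays on stack `0` as fuel, and the input goes to stack `1`, which is the shifted
stack `0` of the simulated program. -/
theorem verifier_prefix (A : List Bool → Bool → Prop) (x : List Bool) {q s n}
    (h : Runs A q (scons (split x).2 (initStore (split x).1)) n s) :
    ∃ m ≤ 20 * x.length + 30 + n, Runs A (readField 0 2 3 ;; transfer 2 [1] ;; q) (initStore x) m s := by
  obtain ⟨n₁, hn₁, r₁⟩ := (readField_yields (A := A) (i := 0) (j := 2) (c := 3) (by simp)
    (by simp) (by simp) (initStore x) rfl).1
  obtain ⟨n₂, hn₂, r₂⟩ := ((move_yields (A := A) (i := 2) (j := 1) (by simp)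
    (update (update (initStore x) 0 (split (initStore x 0)).2) 2
      ((split (initStore x 0)).1.reverse ++ initStore x 2))).congr
    (s₂ := scons (split x).2 (initStore (split x).1)) (by
      funext k
      match k with
      | 0 => simp [initStore]
      | 1 => simp [initStore]
      | 2 => simp [initStore]
      | k + 3 => simp [initStore]) le_rfl).1
  have := length_split x
  refine ⟨_, ?_, r₁.seq (r₂.seq h)⟩
  simp [initStore] at hn₁ hn₂
  omega

/-- Exhausted fuel may mean a truncated simulation, whose result must not count, so the answer is
then negative. -/
theorem exists_runs_answer (A : List Bool → Bool → Prop) (S : List Bool) (t : Store) :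
    ∃ n ≤ 3, ∃ s, Runs A (.branch 0 .skip
      (.branch 1 (.push false 0) (.push false 0) (.push true 0))
      (.branch 1 (.push false 0) (.push false 0) (.push true 0))) (scons S t) n s ∧
      (Accepts s ↔ S ≠ [] ∧ Accepts t) := by
  have key : ∃ s, Runs A (.branch 1 (.push false 0) (.push false 0) (.push true 0))
      (scons S t) 2 s ∧ (Accepts s ↔ Accepts t) := by
    rcases hl : t 0 with _ | ⟨_ | _, l⟩
    · exact ⟨_, .branch_nil hl (.push _ _ _), by simp [Accepts, hl]⟩
    · exact ⟨_, .branch_false hl (.push _ _ _), by simp [Accepts, hl]⟩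
    · exact ⟨_, .branch_true hl (.push _ _ _), by simp [Accepts, hl]⟩
  obtain ⟨s, hs, ha⟩ := key
  rcases S with _ | ⟨_ | _, S⟩
  · exact ⟨2, by simp, _, .branch_nil rfl (.skip _), by simp [Accepts]⟩
  · exact ⟨3, le_rfl, s, .branch_false rfl hs, by simp [ha]⟩
  · exact ⟨3, le_rfl, s, .branch_true rfl hs, by simp [ha]⟩

/-- The strings accepted by a deterministic program without an oracle. -/
def acceptedBy (p : Prog) : Language Bool :=
  fun x => ∃ n s, Runs (answers 0) p (initStore x) n s ∧ Accepts s

theorem acceptedBy_iff {p x n s} (h : Runs (answers 0) p (initStore x) n s) :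
    x ∈ acceptedBy p ↔ Accepts s :=
  ⟨fun ⟨_, _, h', ha⟩ => h.unique h' ▸ ha, fun ha => ⟨_, _, h, ha⟩⟩

theorem size_initStore_le (N : ℕ) (x : List Bool) : size N (initStore x) ≤ x.length := by
  unfold size initStore
  rw [Finset.sum_congr rfl (g := fun i => if i = 0 then x.length else 0)
    (fun i _ => by split_ifs <;> rfl), Finset.sum_ite_eq']
  split_ifs <;> simp

theorem exists_runs_verifier (p : Prog) : ∃ c, ∀ x, ∃ n ≤ c * x.length + c, ∃ s,
    Runs (answers 0) (verifier p) (initStore x) n s ∧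
      (Accepts s → ∃ m t, Runs guesses p (initStore (split x).1) m t ∧ Accepts t) := by
  obtain ⟨c, hc⟩ := exists_runs_clocked (answers 0) p
  refine ⟨c + 50, fun x => ?_⟩
  obtain ⟨n, S, t, h, hS, ht, hr⟩ := hc _ le_rfl (split x).2 (initStore (split x).1)
  obtain ⟨m, hm, s, h', ha⟩ := exists_runs_answer (answers 0) S t
  obtain ⟨k, hk, h''⟩ := verifier_prefix (answers 0) x (h.seq h')
  refine ⟨k, ?_, s, h'', fun h => ?_⟩
  · have := length_split x
    have := size_initStore_le (stackBound p) (split x).1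
    have : (split x).2.length ≤ x.length := by omega
    nlinarith
  · obtain ⟨h₁, h₂⟩ := ha.1 h
    obtain ⟨m, r⟩ := hr h₁
    exact ⟨m, t, r, h₂⟩

/-- Nondeterministic polynomial time is contained in `NP`; since polynomials need not be
constructible, only runs within the time bound are guaranteed to count. -/
theorem exists_mem_NP_of_prog (p : Prog) (q : Polynomial ℕ) : ∃ L ∈ NP,
    (∀ z ∈ L, ∃ n t, Runs guesses p (initStore z) n t ∧ Accepts t) ∧
    ∀ z n t, Runs guesses p (initStore z) n t → Accepts t → n ≤ q.eval z.length → z ∈ L := by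
  obtain ⟨c, hc⟩ := exists_runs_verifier p
  have hR : acceptedBy (verifier p) ∈ P := by
    refine mem_PRel_of_runs (verifier p) (Polynomial.C c * Polynomial.X + Polynomial.C c) fun x => ?_
    obtain ⟨n, hn, s, h, -⟩ := hc x
    exact ⟨n, by simpa using hn, s, h, (acceptedBy_iff h).symm⟩
  -- The `+ 1` leaves room for one spare bit, which keeps the fuel nonempty to the end.
  refine ⟨fun z => ∃ w : List Bool, w.length ≤ (q + 1).eval z.length ∧
    pair z w ∈ acceptedBy (verifier p), ⟨_, hR, q + 1, fun _ => Iff.rfl⟩, ?_, ?_⟩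
  · rintro z ⟨w, -, hw⟩
    obtain ⟨n, -, s, h, ha⟩ := hc (pair z w)
    simpa using ha ((acceptedBy_iff h).1 hw)
  · intro z n t h ha hn
    obtain ⟨u, hu, hr⟩ := h.exists_clocked (answers 0)
    obtain ⟨m, hm⟩ := hr [true] (by simp)
    obtain ⟨k, -, s, h', hs⟩ := exists_runs_answer (answers 0) [true] t
    obtain ⟨_, -, h''⟩ := verifier_prefix (answers 0) (pair z (u ++ [true]))
      (q := _) (by simpa using hm.seq h')
    refine ⟨u ++ [true], ?_, (acceptedBy_iff h'').2 (hs.2 ⟨by simp, ha⟩)⟩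
    simp
    omega

/-! ### Simulating a program inside another one. -/

/-- Rename the stacks of a program along `σ` and replace its queries by programs. -/
def implement (σ : ℕ → ℕ) (Q : ℕ → ℕ → Prog) : Prog → Prog
  | .skip => .skip
  | .push b i => .push b (σ i)
  | .pop i => .pop (σ i)
  | .query i j => Q i j
  | .seq p q => implement σ Q p ;; implement σ Q q
  | .branch i p q r => .branch (σ i) (implement σ Q p) (implement σ Q q) (implement σ Q r)
  | .loop i p => .loop (σ i) (implement σ Q p)

/-- `extend σ t base` is the store that holds the simulated store `t` on the stacks in the range of
`σ` and agrees with `base` elsewhere. -/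
theorem update_extend {σ : ℕ → ℕ} (hσ : Injective σ) (t base : Store) (j : ℕ) (l : List Bool) :
    update (extend σ t base) (σ j) l = extend σ (update t j l) base := by
  funext k
  by_cases hk : ∃ i, σ i = k
  · obtain ⟨i, rfl⟩ := hk
    by_cases hij : i = j
    · subst hij; simp [hσ.extend_apply]
    · simp [hσ.extend_apply, hσ.ne hij, hij]
  · rw [update_of_ne (fun h => hk ⟨j, h.symm⟩), extend_apply' _ _ _ hk, extend_apply' _ _ _ hk]

/-- `Q` has to be correct only for queries of length at most `M`; `hM` guarantees this throughout
the run, since a step lengthens a stack by at most one bit. -/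
theorem Runs.yields_implement {A B : List Bool → Bool → Prop} {σ : ℕ → ℕ} (hσ : Injective σ)
    {Q : ℕ → ℕ → Prog} {M c : ℕ} {base : Store} (hc : 1 ≤ c)
    (hQ : ∀ t i j b, A (t i) b → (t i).length ≤ M →
      Yields B (Q i j) (extend σ t base) c (extend σ (update t j (b :: t j)) base))
    {p t n t'} (h : Runs A p t n t') (hM : ∀ i, (t i).length + n ≤ M) :
    Yields B (implement σ Q p) (extend σ t base) (c * n) (extend σ t' base) := by
  induction h with
  | skip s => exact (Yields.skip _).mono (by omega)
  | push b i s =>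
    refine (Yields.push b (σ i) _).congr ?_ (by omega)
    rw [hσ.extend_apply, update_extend hσ]
  | pop i s =>
    refine (Yields.pop (σ i) _).congr ?_ (by omega)
    rw [hσ.extend_apply, update_extend hσ]
  | query i j s b h => exact (hQ s i j b h (by have := hM i; omega)).mono (by omega)
  | seq h₁ h₂ ih₁ ih₂ =>
    refine ((ih₁ fun i => ?_).seq (ih₂ fun i => ?_)).mono (by nlinarith)
    · have := hM i; omega
    · have := hM i; have := h₁.length_le i; omega
  | branch_nil h h₁ ih =>
    exact ((ih fun i => by have := hM i; omega).branch_nil (by rwa [hσ.extend_apply])).mono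
      (by nlinarith)
  | branch_false h h₁ ih =>
    exact ((ih fun i => by have := hM i; omega).branch_false (by rwa [hσ.extend_apply])).mono
      (by nlinarith)
  | branch_true h h₁ ih =>
    exact ((ih fun i => by have := hM i; omega).branch_true (by rwa [hσ.extend_apply])).mono
      (by nlinarith)
  | loop_nil h => exact (Yields.loop_nil (by rwa [hσ.extend_apply])).mono (by omega)
  | loop_cons h h₁ h₂ ih₁ ih₂ =>
    refine ((ih₁ fun i => ?_).loop_cons (by rwa [hσ.extend_apply]) (ih₂ fun i => ?_)).mono
      (by nlinarith)
    · have := hM i; omega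
    · have := hM i; have := h₁.length_le i; omega

/-- Empty the stacks `σ 0, …, σ (N - 1)`. -/
def clearAll (σ : ℕ → ℕ) : ℕ → Prog
  | 0 => .skip
  | N + 1 => transfer (σ N) [] ;; clearAll σ N

theorem clearAll_yields {A} {σ : ℕ → ℕ} (hσ : Injective σ) {M : ℕ} (N : ℕ) (t base : Store)
    (hM : ∀ i, (t i).length ≤ M) (hN : ∀ i, N ≤ i → t i = []) :
    Yields A (clearAll σ N) (extend σ t base) (N * (5 * M + 2) + 1)
      (extend σ (fun _ => []) base) := by
  induction N generalizing t with
  | zero =>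
    obtain rfl : t = fun _ => [] := funext fun i => hN i (Nat.zero_le i)
    exact (Yields.skip _).mono (by omega)
  | succ N ih =>
    have h := clear_yields (A := A) (σ N) (extend σ t base)
    rw [hσ.extend_apply, update_extend hσ] at h
    refine (h.seq (ih _ (fun i => ?_) fun i hi => ?_)).mono ?_
    · by_cases hi : i = N <;> simp [hi, hM]
    · by_cases hi' : i = N
      · simp [hi']
      · rw [update_of_ne hi', hN i (by omega)]
    · have := hM N
      nlinarith

/-- A program that does not halt. -/
def diverge : Prog := .push true 5 ;; .loop 5 .skip

theorem not_runs_diverge {A s n s'} : ¬ Runs A diverge s n s' := by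
  have key : ∀ n s, s 5 ≠ [] → ¬ Runs A (.loop 5 .skip) s n s' := by
    intro n
    induction n using Nat.strong_induction_on with
    | _ n ih =>
    intro s hs h
    cases h with
    | loop_nil h => exact hs h
    | loop_cons _ h₁ h₂ =>
      cases h₁
      exact ih _ (by omega) _ hs h₂
  intro h
  cases h with
  | seq h₁ h₂ =>
    cases h₁
    exact key _ _ (by simp) h₂

/-! ### Tables of advice and their lookup. -/

/-- The strings of a list one after the other, in the format of `readField`. -/
def pack (es : List (List Bool)) : List Bool := es.foldr (fun e acc => pair e.reverse acc) []

@[simp] theorem pack_nil : pack [] = [] := rfl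

-- Entries are stored reversed because `readField` reverses what it decodes.
@[simp] theorem pack_cons (e es) : pack (e :: es) = pair e.reverse (pack es) := rfl

/-- Remove as many strings from stack `9` as there are bits on stack `8`. -/
def skipFields : Prog := .loop 8 (.pop 8 ;; readField 9 10 5 ;; transfer 10 [])

theorem skipFields_yields {A} {B : ℕ} (es : List (List Bool)) (s : Store) (h₉ : s 9 = pack es)
    (h₅ : s 5 = []) (h₁₀ : s 10 = []) (hB : (pack es).length ≤ B) :
    Yields A skipFields s ((s 8).length * (15 * B + 30) + 1)
      (update (update s 8 []) 9 (pack (es.drop (s 8).length))) := by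
  generalize hl : s 8 = l
  induction l generalizing s es with
  | nil =>
    refine (Yields.loop_nil hl).congr ?_ (by simp)
    rw [List.length_nil, List.drop_zero, ← h₉, ← hl]
    simp
  | cons b l ih =>
    have e : (split (pack es)).2 = pack es.tail ∧ (split (pack es)).1.length ≤ B ∧
        (pack es.tail).length ≤ B := by
      cases es with
      | nil => exact ⟨rfl, Nat.zero_le _, hB⟩
      | cons e es =>
        simp only [pack_cons, length_pair, List.length_reverse] at hB
        simp only [pack_cons, split_pair, List.tail_cons, List.length_reverse, true_and]
        omega
    have h₁ := readField_yields (A := A) (i := 9) (j := 10) (c := 5) (by simp) (by simp) (by simp)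
      (update s 8 l) (by simp [h₅])
    have h₂ := clear_yields (A := A) 10 (update (update (update s 8 l) 9
      (split (update s 8 l 9)).2) 10 ((split (update s 8 l 9)).1.reverse ++ update s 8 l 10))
    have h₀ := Yields.pop (A := A) 8 s
    simp only [hl, List.tail_cons] at h₀
    have body : Yields A (.pop 8 ;; readField 9 10 5 ;; transfer 10 []) s (15 * B + 28)
        (update (update s 8 l) 9 (pack es.tail)) := by
      refine (h₀.seq (h₁.seq h₂)).congr ?_ ?_
      · simp [h₉, e.1, h₁₀]
      · simp [h₉, h₁₀]
        omega
    refine (body.loop_cons (by simp [hl]) (ih es.tail _ (by simp) (by simp [h₅]) (by simp [h₁₀])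
      e.2.2 (by simp))).congr ?_ (by simp; ring_nf; omega)
    funext k
    simp only [update_apply]
    split_ifs <;> simp_all

/-- Look up the entry of the table on stack `g` for the length of the string on stack `c`. -/
def locate (g c : ℕ) : Prog :=
  transfer c [6, 7, 8] ;; transfer 6 [c] ;; copyReverse g 9 6 ;; skipFields ;;
    readField 9 11 5 ;; transfer 9 [] ;; readField 11 12 5

/-- The working stacks are empty. -/
structure Ready (s : Store) : Prop where
  -- Stacks 5 to 12 are scratch space, the odd stacks from 21 on belong to the certificate checker,
  -- and the even ones from 20 on to the simulated oracle machine. Stacks 0 to 4 hold the data of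
  -- the vote.
  glue : ∀ k, 5 ≤ k → k ≤ 12 → s k = []
  odd : ∀ i, s (2 * i + 21) = []

theorem length_pack_drop_le (es : List (List Bool)) (n : ℕ) :
    (pack (es.drop n)).length ≤ (pack es).length := by
  induction n generalizing es with
  | zero => simp
  | succ n ih =>
    cases es with
    | nil => simp
    | cons e es =>
      refine (ih es).trans ?_
      simp [length_pair]; omega

/-- Of the three copies of the query, the one on stack 6 restores stack `c`, the one on 7 is kept
for `combine`, and the one on 8 serves as a unary counter of the entries to skip. Skipping up to `B`
entries at linear cost each gives the quadratic term. -/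
theorem locate_yields {A} {g c : ℕ} (hg : g = 2 ∨ g = 3) (hc : 20 ≤ c) {s : Store} (hs : Ready s)
    {es es' : List (List Bool)} {f u : List Bool} {B : ℕ} (hes : s g = (pack es).reverse)
    (hd : es.drop (s c).length = pair f u :: es')
    (hB : (s c).length ≤ B) (hB' : (pack es).length ≤ B) :
    Yields A (locate g c) s (15 * B ^ 2 + 200 * B + 200)
      (update (update (update s 7 (s c).reverse) 11 u) 12 f.reverse) := by
  generalize hy : s c = y at *
  have h₅ := hs.glue 5 (by simp) (by simp)
  have h₆ := hs.glue 6 (by simp) (by simp)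
  have h₇ := hs.glue 7 (by simp) (by simp)
  have h₈ := hs.glue 8 (by simp) (by simp)
  have h₉ := hs.glue 9 (by simp) (by simp)
  have h₁₀ := hs.glue 10 (by simp) (by simp)
  have h₁₁ := hs.glue 11 (by simp) (by simp)
  have h₁₂ := hs.glue 12 (by simp) (by simp)
  have hlen := length_pack_drop_le es y.length
  rw [hd] at hlen
  simp only [pack_cons, length_pair, List.length_reverse] at hlen
  have c6 : c ≠ 6 := by omega
  have c7 : c ≠ 7 := by omega
  have c8 : c ≠ 8 := by omega
  have g7 : g ≠ 7 := by omega
  have g8 : g ≠ 8 := by omega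
  have g9 : g ≠ 9 := by omega
  have g6 : g ≠ 6 := by omega
  have a₁ : Yields A (transfer c [6, 7, 8]) s (11 * B + 1)
      (update (update (update (update s c []) 6 y.reverse) 7 y.reverse) 8 y.reverse) := by
    refine (transfer_yields c [6, 7, 8] (by simp; omega) s).congr ?_ (by simp [hy]; omega)
    funext k
    by_cases k1 : k = c
    · subst k1; simp [c6, c7, c8]
    by_cases k2 : k = 6
    · subst k2; simp [k1, hy, h₆]
    by_cases k3 : k = 7
    · subst k3; simp [k1, hy, h₇]
    by_cases k4 : k = 8
    · subst k4; simp [k1, hy, h₈]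
    simp [k1, k2, k3, k4, Ne.symm k2, Ne.symm k3, Ne.symm k4, flatMap_nil]
  have a₂ : Yields A (transfer 6 [c])
      (update (update (update (update s c []) 6 y.reverse) 7 y.reverse) 8 y.reverse) (7 * B + 1)
      (update (update s 7 y.reverse) 8 y.reverse) := by
    refine (move_yields (A := A) (i := 6) (j := c) (by omega) _).congr ?_ (by simp; omega)
    simp [c6, c7, c8]
    funext k
    simp only [update_apply]
    split_ifs <;> simp_all
  have a₃ : Yields A (copyReverse g 9 6) (update (update s 7 y.reverse) 8 y.reverse) (16 * B + 3)
      (update (update (update s 7 y.reverse) 8 y.reverse) 9 (pack es)) := by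
    refine (copyReverse_yields (A := A) (i := g) (j := 9) (t := 6) g9 g6 (by simp) _
      (by simp [h₆])).congr ?_ (by simp [g7, g8, hes]; omega)
    simp [g7, g8, hes, h₉]
  have a₄ : Yields A skipFields (update (update (update s 7 y.reverse) 8 y.reverse) 9 (pack es))
      (B * (15 * B + 30) + 1) (update (update s 7 y.reverse) 9 (pack (pair f u :: es'))) := by
    refine (skipFields_yields (A := A) es _ (by simp) (by simp [h₅]) (by simp [h₁₀]) hB').congr ?_
      (by simp; gcongr)
    simp [hd, -pack_cons]
    funext k
    simp only [update_apply]
    split_ifs <;> simp_all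
  have a₅ : Yields A (readField 9 11 5) (update (update s 7 y.reverse) 9 (pack (pair f u :: es')))
      (10 * B + 20) (update (update (update s 7 y.reverse) 9 (pack es')) 11 (pair f u)) := by
    refine (readField_yields (A := A) (i := 9) (j := 11) (c := 5) (by simp) (by simp) (by simp) _
      (by simp [h₅])).congr ?_ (by simp [length_pair]; omega)
    simp [h₁₁]
  have a₆ : Yields A (transfer 9 []) (update (update (update s 7 y.reverse) 9 (pack es')) 11
      (pair f u)) (5 * B + 1) (update (update s 7 y.reverse) 11 (pair f u)) := by
    refine (clear_yields (A := A) 9 _).congr ?_ (by simp; omega)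
    funext k
    simp only [update_apply]
    split_ifs <;> simp_all
  have a₇ : Yields A (readField 11 12 5) (update (update s 7 y.reverse) 11 (pair f u))
      (10 * B + 20) (update (update (update s 7 y.reverse) 11 u) 12 f.reverse) := by
    refine (readField_yields (A := A) (i := 11) (j := 12) (c := 5) (by simp) (by simp) (by simp) _
      (by simp [h₅])).congr ?_ (by simp [length_pair]; omega)
    simp [h₁₂]
  exact (a₁.seq (a₂.seq (a₃.seq (a₄.seq (a₅.seq (a₆.seq a₇)))))).mono (by nlinarith)

theorem Runs.congr {A p s n s₁ s₂} (h : Runs A p s n s₁) (e : s₁ = s₂) : Runs A p s n s₂ := e ▸ h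

/-! ### Guessing and checking certificates. -/

/-- Guess a string on stack `21` that is no longer than the string on stack `11`. -/
def guess : Prog := .loop 11 (.pop 11 ;; .query 0 5 ;; .branch 5 .skip (.pop 5) (.pop 5 ;; .query 0 21))

theorem runs_guess {w : List Bool} {s : Store} (h₅ : s 5 = []) (hw : w.length ≤ (s 11).length) :
    ∃ n ≤ (s 11).length * 12 + 1,
      Runs guesses guess s n (update (update s 11 []) 21 (w ++ s 21)) := by
  generalize hl : s 11 = l at *
  induction l generalizing s w with
  | nil =>
    obtain rfl : w = [] := by simpa using hw
    refine ⟨1, by simp, ?_⟩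
    have : update (update s 11 []) 21 ([] ++ s 21) = s := by
      funext k
      simp only [update_apply]
      split_ifs <;> simp_all
    rw [this]
    exact .loop_nil hl
  | cons b l ih =>
    have h₀ := Runs.pop (A := guesses) 11 s
    have h₁ (b) := Runs.query (A := guesses) 0 5 (update s 11 (s 11).tail) b trivial
    simp only [hl, List.tail_cons] at h₀ h₁
    -- Stack 21 grows from the bottom, so the bit guessed first is the last one of `w`. The coin on
    -- stack 5 may also waste a unit of stack 11, which makes shorter strings possible.
    rcases List.eq_nil_or_concat' w with rfl | ⟨w, a, rfl⟩
    · obtain ⟨n, hn, hr⟩ := ih (w := []) (s := update s 11 l) (by simp [h₅]) (by simp) (by simp)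
      have h₂ : Runs guesses (.branch 5 .skip (.pop 5) (.pop 5 ;; .query 0 21)) _ 2 _ :=
        .branch_false (by simp; rfl) (.pop 5 (update (update s 11 l) 5 (false :: update s 11 l 5)))
      have e : update (update (update s 11 l) 5 (false :: update s 11 l 5)) 5
          (update (update s 11 l) 5 (false :: update s 11 l 5) 5).tail = update s 11 l := by
        simp
      rw [e] at h₂
      have := Runs.loop_cons (by simp [hl]) (h₀.seq ((h₁ false).seq h₂)) hr
      refine ⟨_, ?_, this.congr (by simp)⟩
      simp; omega
    · obtain ⟨n, hn, hr⟩ := ih (w := w) (s := update (update s 11 l) 21 (a :: update s 11 l 21))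
        (by simp [h₅]) (by simp) (by simpa using hw)
      have h₂ : Runs guesses (.branch 5 .skip (.pop 5) (.pop 5 ;; .query 0 21)) _ 4 _ :=
        .branch_true (by simp; rfl)
          ((Runs.pop 5 (update (update s 11 l) 5 (true :: update s 11 l 5))).seq
            (.query 0 21 _ a trivial))
      have e : update (update (update s 11 l) 5 (true :: update s 11 l 5)) 5
          (update (update s 11 l) 5 (true :: update s 11 l 5) 5).tail = update s 11 l := by
        simp
      rw [e] at h₂
      have := Runs.loop_cons (by simp [hl]) (h₀.seq ((h₁ true).seq h₂)) hr
      refine ⟨_, ?_, this.congr ?_⟩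
      · simp; omega
      · funext k
        simp only [update_apply]
        split_ifs <;> simp_all

/-- The converse of `runs_guess`, needed to control all runs and not just a favourable one. -/
theorem Runs.eq_of_guess {s s' : Store} {n : ℕ} (h : Runs guesses guess s n s') (h₅ : s 5 = []) :
    ∃ w : List Bool, w.length ≤ (s 11).length ∧ s' = update (update s 11 []) 21 (w ++ s 21) := by
  generalize hl : s 11 = l
  induction l generalizing s n with
  | nil =>
    refine ⟨[], by simp, ?_⟩
    cases h with
    | loop_nil h =>
      funext k
      simp only [update_apply]
      split_ifs <;> simp_all
    | loop_cons h => exact absurd hl h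
  | cons b l ih =>
    cases h with
    | loop_nil h => simp [hl] at h
    | loop_cons _ h h' =>
    cases h with
    | seq h₁ h₂ =>
    cases h₁
    cases h₂ with
    | seq h₂ h₃ =>
    cases h₂ with
    | query _ _ _ b _ =>
    cases h₃ with
    | branch_nil h => simp at h
    | branch_false h h₃ =>
      cases h₃
      obtain ⟨w, hw, e⟩ := ih h' (by simp [h₅]) (by simp [hl])
      refine ⟨w, by simp; omega, ?_⟩
      rw [e]
      funext k
      simp only [update_apply]
      split_ifs <;> simp_all
    | branch_true h h₃ =>
      cases h₃ with
      | seq h₃ h₄ =>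
      cases h₃
      cases h₄ with
      | query _ _ _ a _ =>
      obtain ⟨w, hw, e⟩ := ih h' (by simp [h₅]) (by simp [hl])
      refine ⟨w ++ [a], by simpa using hw, ?_⟩
      rw [e]
      funext k
      simp only [update_apply]
      split_ifs <;> simp_all

/-- Given `w`, `f` reversed and `y` reversed on the stacks `21`, `12` and `7`, combine them to
`pair (pair y f) w` on stack `21`. -/
def combine : Prog :=
  .push true 21 ;; .push false 21 ;; transfer 12 [21, 21] ;; .push true 21 ;; .push true 21 ;;
    .push false 21 ;; .push false 21 ;; transfer 7 [21, 21, 21, 21]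

/-- The string is built from back to front: the separator `01`, then `f` doubled, then the inner
separator, which doubling turns into `0011`, then `y` with each bit four times. -/
theorem combine_yields {A} {s : Store} {y f : List Bool} {B : ℕ} (h₇ : s 7 = y.reverse)
    (h₁₂ : s 12 = f.reverse) (hy : y.length ≤ B) (hf : f.length ≤ B) :
    Yields A combine s (22 * B + 20)
      (update (update (update s 12 []) 7 []) 21 (pair (pair y f) (s 21))) := by
  refine ((Yields.push (A := A) true 21 s).seq ((Yields.push false 21 _).seq
    ((move_double_yields (i := 12) (j := 21) (by simp) _).seq ((Yields.push true 21 _).seq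
    ((Yields.push true 21 _).seq ((Yields.push false 21 _).seq ((Yields.push false 21 _).seq
    (move_quadruple_yields (i := 7) (j := 21) (by simp) _)))))))).congr ?_ ?_
  · simp [h₇, h₁₂, pair_eq, double_append]
    funext k
    simp only [update_apply]
    split_ifs <;> simp_all [double]
  · simp [h₇, h₁₂]
    omega

open Polynomial

theorem eval_le_eval (q : ℕ[X]) {a b : ℕ} (h : a ≤ b) : q.eval a ≤ q.eval b := by
  induction q using Polynomial.induction_on' with
  | add p q hp hq => simp only [eval_add]; omega
  | monomial n c => simp only [eval_monomial]; gcongr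

/-- Run the program `v` on the string on stack `21`; halt only if `v` accepts, and then leave the odd
stacks empty. -/
def call (v : Prog) : Prog :=
  implement (fun i => 2 * i + 21) (fun _ j => .push false (2 * j + 21)) v ;;
    .branch 21 diverge diverge .skip ;; clearAll (fun i => 2 * i + 21) (stackBound v + 1)

theorem injective_odd : Injective fun i : ℕ => 2 * i + 21 := fun a b h => by
  simp at h; omega

theorem injective_even : Injective fun i : ℕ => 2 * i + 20 := fun a b h => by
  simp at h; omega

theorem extend_of_forall {σ : ℕ → ℕ} (hσ : Injective σ) {t s base : Store} (h : ∀ i, s (σ i) = t i)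
    (h' : ∀ k, (∀ i, σ i ≠ k) → s k = base k) : extend σ t base = s := by
  funext k
  by_cases hk : ∃ i, σ i = k
  · obtain ⟨i, rfl⟩ := hk
    rw [hσ.extend_apply, h]
  · rw [extend_apply' _ _ _ hk, h' k (fun i e => hk ⟨i, e⟩)]

/-- With the empty oracle every answer is 0, so a query can be replaced by pushing `false`. -/
theorem implement_yields_of_ready {s : Store} (hs : Ready s) {v : Prog} {Z : List Bool} {n : ℕ}
    {t : Store} (h : Runs (answers 0) v (initStore Z) n t) :
    Yields guesses (implement (fun i => 2 * i + 21) (fun _ j => .push false (2 * j + 21)) v)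
      (update s 21 Z) n (extend (fun i => 2 * i + 21) t s) := by
  have e : extend (fun i => 2 * i + 21) (initStore Z) s = update s 21 Z := by
    refine extend_of_forall injective_odd (fun i => ?_) fun k hk => ?_
    · by_cases hi : i = 0 <;> simp [hi, initStore, hs.odd]
    · rw [update_of_ne (fun e => hk 0 e.symm)]
  rw [← e]
  refine (h.yields_implement (c := 1) (M := Z.length + n) injective_odd le_rfl ?_ ?_).mono
    (by omega)
  · intro t i j b hb _
    obtain rfl : b = false := by
      cases b
      · rfl
      · exact absurd (hb.1 rfl) (Set.notMem_empty _)
    refine (Yields.push false (2 * j + 21) _).congr ?_ le_rfl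
    rw [injective_odd.extend_apply (g := t) (a := j), update_extend injective_odd (j := j)]
  · intro i
    simp only [initStore]
    split_ifs <;> simp

theorem call_yields {s : Store} (hs : Ready s) {v : Prog} {Z : List Bool} {n : ℕ}
    {t : Store} (h : Runs (answers 0) v (initStore Z) n t) (ht : Accepts t) :
    Yields guesses (call v) (update s 21 Z)
      (n + (stackBound v + 1) * (5 * (Z.length + n) + 2) + 10) s := by
  obtain ⟨l, hl⟩ : ∃ l, t 0 = true :: l := by
    unfold Accepts at ht
    cases h0 : t 0 <;> simp_all
  have hl' : extend (fun i => 2 * i + 21) t s 21 = true :: l :=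
    (injective_odd.extend_apply t s 0).trans hl
  refine ((implement_yields_of_ready hs h).seq (((Yields.skip _).branch_true hl').seq
    (clearAll_yields injective_odd (M := Z.length + n) (stackBound v + 1) t s
      (fun i => ?_) fun i hi => ?_))).congr ?_ ?_
  · refine (h.length_le i).trans ?_
    simp only [initStore]
    split_ifs <;> simp
  · rw [h.eq_of_stackBound_le (by omega), initStore, if_neg (by omega)]
  · exact extend_of_forall injective_odd hs.odd fun _ _ => rfl
  · omega

theorem not_runs_call {s s' : Store} (hs : Ready s) {v : Prog} {Z : List Bool} {n m : ℕ}
    {t : Store} (h : Runs (answers 0) v (initStore Z) n t) (ht : ¬ Accepts t) :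
    ¬ Runs guesses (call v) (update s 21 Z) m s' := by
  intro h'
  cases h' with
  | seq h₁ h₂ =>
  cases (implement_yields_of_ready hs h).2 _ _ h₁
  cases h₂ with
  | seq h₂ _ =>
  cases h₂ with
  | branch_nil _ h => exact not_runs_diverge h
  | branch_false _ h => exact not_runs_diverge h
  | branch_true hl _ =>
    rw [show extend (fun i => 2 * i + 21) t s 21 = t 0 from injective_odd.extend_apply t s 0] at hl
    exact ht (by simp [Accepts, hl])

/-- The program `v` decides `R` in time `t` without using an oracle. -/
def Decides (v : Prog) (t : ℕ[X]) (R : Language Bool) : Prop :=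
  ∀ x : List Bool, ∃ n ≤ t.eval x.length, ∃ s,
    Runs (answers 0) v (initStore x) n s ∧ (Accepts s ↔ x ∈ R)

/-- The entry for the length of `y` in the table `es` is a pair of an advice `f` and a string that is
as long as a witness of `T` may be. -/
def Certifies (R : Language Bool) (es : List (List Bool)) (y : List Bool) (T : Prop) : Prop :=
  ∃ f u es', es.drop y.length = pair f u :: es' ∧
    (T ↔ ∃ w : List Bool, w.length ≤ u.length ∧ pair (pair y f) w ∈ R)

/-- Guess and check a certificate for the string on stack `c`, using the table on stack `g`. -/
def verify (g c : ℕ) (v : Prog) : Prog := locate g c ;; guess ;; combine ;; call v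

/-- A bound for the running time of `verify`. -/
noncomputable def verifyTime (v : Prog) (t : ℕ[X]) : ℕ[X] :=
  15 * X ^ 2 + 300 * X + 300 + t.comp (7 * X + 6) +
    C (stackBound v + 1) * (5 * (7 * X + 6 + t.comp (7 * X + 6)) + 2)

section verify

variable {g c : ℕ} {s : Store} {es : List (List Bool)} {B : ℕ} {v : Prog} {t : ℕ[X]}
  {R : Language Bool} {T : Prop}

theorem verify_aux (hg : g = 2 ∨ g = 3) (hc : 20 ≤ c) (hs : Ready s)
    (hes : s g = (pack es).reverse) (hB : (s c).length ≤ B) (hB' : (pack es).length ≤ B)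
    (hT : Certifies R es (s c) T) : ∃ f u : List Bool, f.length ≤ B ∧ u.length ≤ B ∧
      (T ↔ ∃ w : List Bool, w.length ≤ u.length ∧ pair (pair (s c) f) w ∈ R) ∧
      Yields guesses (locate g c) s (15 * B ^ 2 + 200 * B + 200)
        (update (update (update s 7 (s c).reverse) 11 u) 12 f.reverse) ∧
      ∀ w, Yields guesses combine (update (update (update (update (update s 7 (s c).reverse) 11 u) 12
        f.reverse) 11 []) 21 w) (22 * B + 20) (update s 21 (pair (pair (s c) f) w)) := by
  obtain ⟨f, u, es', hd, hT⟩ := hT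
  have hlen := length_pack_drop_le es (s c).length
  rw [hd] at hlen
  simp only [pack_cons, length_pair, List.length_reverse] at hlen
  refine ⟨f, u, by omega, by omega, hT, locate_yields hg hc hs hes hd hB hB', fun w => ?_⟩
  refine (combine_yields (y := s c) (f := f) (B := B) (by simp) (by simp) hB (by omega)).congr ?_
    le_rfl
  have h₇ := hs.glue 7 (by simp) (by simp)
  have h₁₁ := hs.glue 11 (by simp) (by simp)
  have h₁₂ := hs.glue 12 (by simp) (by simp)
  funext k
  simp only [update_apply]
  split_ifs <;> simp_all

/-- A valid witness gives a halting run. Any other guess either passes the check as well, and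
cleaning up then restores `s`, or it leads to `diverge`. So `s` is the outcome whichever string was
guessed. -/
theorem verify_yields (hg : g = 2 ∨ g = 3) (hc : 20 ≤ c) (hs : Ready s)
    (hes : s g = (pack es).reverse) (hB : (s c).length ≤ B) (hB' : (pack es).length ≤ B)
    (hv : Decides v t R) (hT : Certifies R es (s c) T) (h : T) :
    Yields guesses (verify g c v) s ((verifyTime v t).eval B) s := by
  obtain ⟨f, u, hf, hu, hT, h₁, h₂⟩ := verify_aux hg hc hs hes hB hB' hT
  obtain ⟨w, hw, hwR⟩ := hT.1 h
  have h₅ := hs.glue 5 (by simp) (by simp)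
  have h₂₁ : s 21 = [] := hs.odd 0
  constructor
  · obtain ⟨n₁, hn₁, r₁⟩ := h₁.1
    obtain ⟨n₂, hn₂, r₂⟩ := runs_guess (w := w)
      (s := update (update (update s 7 (s c).reverse) 11 u) 12 f.reverse) (by simp [h₅])
      (by simpa using hw)
    obtain ⟨n₃, hn₃, r₃⟩ := (h₂ w).1
    obtain ⟨n₄, hn₄, t', r₄, ha⟩ := hv (pair (pair (s c) f) w)
    obtain ⟨n₅, hn₅, r₅⟩ := (call_yields hs r₄ (ha.2 hwR)).1
    refine ⟨_, ?_, r₁.seq ((r₂.congr (by simp [h₂₁])).seq (r₃.seq r₅))⟩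
    -- `2 * (2 * B + B + 2) + B + 2 = 7 * B + 6`.
    have hZ : (pair (pair (s c) f) w).length ≤ 7 * B + 6 := by
      simp [length_pair]
      omega
    have hn₄' := hn₄.trans (eval_le_eval t hZ)
    have : (stackBound v + 1) * (5 * ((pair (pair (s c) f) w).length + n₄) + 2) ≤
        (stackBound v + 1) * (5 * (7 * B + 6 + t.eval (7 * B + 6)) + 2) := by gcongr
    simp [verifyTime] at hn₂ ⊢
    omega
  · intro n s'' hr
    cases hr with
    | seq k₁ k₂ =>
    cases h₁.2 _ _ k₁
    cases k₂ with
    | seq k₂ k₃ =>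
    obtain ⟨w', hw', rfl⟩ := k₂.eq_of_guess (by simp [h₅])
    cases k₃ with
    | seq k₃ k₄ =>
    cases (h₂ w').2 _ _ (by simpa [h₂₁] using k₃)
    obtain ⟨n₄, hn₄, t', r₄, ha⟩ := hv (pair (pair (s c) f) w')
    by_cases ht : Accepts t'
    · exact (call_yields hs r₄ ht).2 _ _ k₄
    · exact absurd k₄ (not_runs_call hs r₄ ht)

theorem not_runs_verify (hg : g = 2 ∨ g = 3) (hc : 20 ≤ c) (hs : Ready s)
    (hes : s g = (pack es).reverse) (hB : (s c).length ≤ B) (hB' : (pack es).length ≤ B)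
    (hv : Decides v t R) (hT : Certifies R es (s c) T) (h : ¬ T) {n : ℕ} {s' : Store} :
    ¬ Runs guesses (verify g c v) s n s' := by
  obtain ⟨f, u, hf, hu, hT, h₁, h₂⟩ := verify_aux hg hc hs hes hB hB' hT
  have h₅ := hs.glue 5 (by simp) (by simp)
  have h₂₁ : s 21 = [] := hs.odd 0
  intro hr
  cases hr with
  | seq k₁ k₂ =>
  cases h₁.2 _ _ k₁
  cases k₂ with
  | seq k₂ k₃ =>
  obtain ⟨w', hw', rfl⟩ := k₂.eq_of_guess (by simp [h₅])
  cases k₃ with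
  | seq k₃ k₄ =>
  cases (h₂ w').2 _ _ (by simpa [h₂₁] using k₃)
  obtain ⟨n₄, hn₄, t', r₄, ha⟩ := hv (pair (pair (s c) f) w')
  refine not_runs_call hs r₄ (fun ht => h (hT.2 ⟨w', by simpa using hw', ha.1 ht⟩)) k₄

end verify

/-! ### Replacing the oracle by certified guesses. -/

/-- Guess the answer to the query of the string on stack `2 * i + 20`, check it, and push it on stack
`2 * j + 20`. -/
def answer (v₁ v₀ : Prog) (i j : ℕ) : Prog :=
  .query 0 5 ;; .branch 5 .skip
    (.pop 5 ;; verify 3 (2 * i + 20) v₀ ;; .push false (2 * j + 20))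
    (.pop 5 ;; verify 2 (2 * i + 20) v₁ ;; .push true (2 * j + 20))

/-- Everything that is needed to verify answers of the oracle `O` to queries of length at most `M`. -/
structure Setup (O : Language Bool) (v₁ v₀ : Prog) (t₁ t₀ : ℕ[X]) (es₁ es₀ : List (List Bool))
    (M B : ℕ) : Prop where
  exists_language : ∃ R₁ R₀, Decides v₁ t₁ R₁ ∧ Decides v₀ t₀ R₀ ∧ ∀ y : List Bool, y.length ≤ M →
    Certifies R₁ es₁ y (y ∈ O) ∧ Certifies R₀ es₀ y (y ∉ O)
  le : M ≤ B
  le₁ : (pack es₁).length ≤ B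
  le₀ : (pack es₀).length ≤ B

section answer

variable {O : Language Bool} {v₁ v₀ : Prog} {t₁ t₀ : ℕ[X]} {es₁ es₀ : List (List Bool)} {M B : ℕ}

/-- A bound for the running time of `answer`. -/
noncomputable def answerTime (v₁ v₀ : Prog) (t₁ t₀ : ℕ[X]) : ℕ[X] :=
  verifyTime v₁ t₁ + verifyTime v₀ t₀ + 10

/-- Here membership in both NP/poly and coNP/poly is used: the right bit has a certificate, so some
run halts, and for the wrong bit `verify` has no halting run at all. -/
theorem answer_yields (H : Setup O v₁ v₀ t₁ t₀ es₁ es₀ M B) {s : Store} (hs : Ready s)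
    (h₂ : s 2 = (pack es₁).reverse) (h₃ : s 3 = (pack es₀).reverse) {i : ℕ} (j : ℕ)
    (hM : (s (2 * i + 20)).length ≤ M) {b : Bool} (hb : answers O (s (2 * i + 20)) b) :
    Yields guesses (answer v₁ v₀ i j) s ((answerTime v₁ v₀ t₁ t₀).eval B)
      (update s (2 * j + 20) (b :: s (2 * j + 20))) := by
  obtain ⟨⟨R₁, R₀, hv₁, hv₀, hR⟩, hMB, hB₁, hB₀⟩ := H
  obtain ⟨c₁, c₀⟩ := hR _ hM
  have hB := hM.trans hMB
  have h₅ := hs.glue 5 (by simp) (by simp)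
  have e (a : Bool) : update (update s 5 (a :: s 5)) 5 (update s 5 (a :: s 5) 5).tail = s := by
    simp
  have hpop (a : Bool) := (Yields.pop (A := guesses) 5 (update s 5 (a :: s 5))).congr (e a) le_rfl
  have yes (h : s (2 * i + 20) ∈ O) := ((hpop true).seq ((verify_yields (.inl rfl) (by omega) hs h₂ hB
    hB₁ hv₁ c₁ h).seq (.push true (2 * j + 20) s)))
  have no (h : s (2 * i + 20) ∉ O) := ((hpop false).seq ((verify_yields (.inr rfl) (by omega) hs h₃ hB
    hB₀ hv₀ c₀ h).seq (.push false (2 * j + 20) s)))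
  have total : Yields guesses (.branch 5 .skip
      (.pop 5 ;; verify 3 (2 * i + 20) v₀ ;; .push false (2 * j + 20))
      (.pop 5 ;; verify 2 (2 * i + 20) v₁ ;; .push true (2 * j + 20))) (update s 5 (b :: s 5))
      ((verifyTime v₁ t₁ + verifyTime v₀ t₀).eval B + 5)
      (update s (2 * j + 20) (b :: s (2 * j + 20))) := by
    rw [eval_add]
    cases b
    · exact ((no fun h => by simpa using hb.2 h).branch_false (by simp; rfl)).mono (by omega)
    · exact ((yes (hb.1 rfl)).branch_true (by simp; rfl)).mono (by omega)
  constructor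
  · obtain ⟨n, hn, r⟩ := total.1
    refine ⟨_, ?_, (Runs.query 0 5 s b trivial).seq r⟩
    simp [answerTime] at hn ⊢
    omega
  · intro n s'' hr
    cases hr with
    | seq k₁ k₂ =>
    cases k₁ with
    | query _ _ _ a _ =>
    by_cases hab : a = b
    · subst hab
      exact total.2 _ _ k₂
    exfalso
    cases k₂ with
    | branch_nil h => simp at h
    | branch_false h k =>
      obtain rfl : a = false := by simp at h; exact h.1
      obtain rfl : b = true := by simpa using Ne.symm hab
      cases k with
      | seq k k' =>
      cases (hpop false).2 _ _ k
      cases k' with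
      | seq k _ =>
      exact not_runs_verify (.inr rfl) (by omega) hs h₃ hB hB₀ hv₀ c₀
        (not_not.2 (hb.1 rfl)) k
    | branch_true h k =>
      obtain rfl : a = true := by simp at h; exact h.1
      obtain rfl : b = false := by simpa using Ne.symm hab
      cases k with
      | seq k k' =>
      cases (hpop true).2 _ _ k
      cases k' with
      | seq k _ =>
      exact not_runs_verify (.inl rfl) (by omega) hs h₂ hB hB₁ hv₁ c₁
        (fun h => by simpa using hb.2 h) k

end answer

/-! ### Random strings that suit all inputs of one length. -/

/-- Derandomization by many samples: if for each `x` less than a third of `Ω` is bad, then some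
`2 * j` samples contain less than `j` bad ones for each `x` simultaneously. -/
theorem exists_samples {X Ω : Type*} [Fintype X] [Fintype Ω] [DecidableEq Ω] [Nonempty Ω]
    (bad : X → Finset Ω) (hbad : ∀ x, 3 * (bad x).card ≤ Fintype.card Ω) {n j : ℕ}
    (hX : Fintype.card X ≤ 2 ^ n) (hj : 6 * (n + 1) ≤ j) :
    ∃ rs : Fin (2 * j) → Ω, ∀ x, (Finset.univ.filter fun i => rs i ∈ bad x).card < j := by
  by_contra! hcon
  -- An exponential moment argument: the product is 2 to the number of bad samples. If each `rs`
  -- fails for some `x`, the sum over `x` is always at least `2 ^ j`.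
  have h₁ : ∀ rs : Fin (2 * j) → Ω, (2 : ℝ) ^ j ≤ ∑ x, ∏ i, if rs i ∈ bad x then (2 : ℝ) else 1 := by
    intro rs
    obtain ⟨x, hx⟩ := hcon rs
    refine le_trans ?_ (Finset.single_le_sum (f := fun x => ∏ i, if rs i ∈ bad x then (2 : ℝ) else 1)
      (fun x _ => Finset.prod_nonneg fun i _ => by split_ifs <;> norm_num) (Finset.mem_univ x))
    rw [Finset.prod_ite, Finset.prod_const_one, mul_one, Finset.prod_const]
    exact pow_le_pow_right₀ (by norm_num) hx
  -- The samples are independent, so the moment factorizes; each factor is at most `4 / 3` of the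
  -- number of points.
  have h₂ : ∀ x, ∑ rs : Fin (2 * j) → Ω, ∏ i, (if rs i ∈ bad x then (2 : ℝ) else 1) =
      ((Fintype.card Ω : ℝ) + (bad x).card) ^ (2 * j) := by
    intro x
    rw [← Fintype.sum_pow (fun ω => if ω ∈ bad x then (2 : ℝ) else 1) (2 * j)]
    congr 1
    have : ∀ ω, (if ω ∈ bad x then (2 : ℝ) else 1) = 1 + if ω ∈ bad x then 1 else 0 := by
      intro ω
      split_ifs <;> norm_num
    simp [this, Finset.sum_add_distrib]
  have hΩ : (0 : ℝ) < Fintype.card Ω := by exact_mod_cast Fintype.card_pos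
  have h₃ : (Fintype.card Ω : ℝ) ^ (2 * j) * 2 ^ j ≤
      2 ^ n * (4 / 3 * (Fintype.card Ω : ℝ)) ^ (2 * j) := by
    calc (Fintype.card Ω : ℝ) ^ (2 * j) * 2 ^ j
        = ∑ _rs : Fin (2 * j) → Ω, (2 : ℝ) ^ j := by simp
      _ ≤ ∑ rs : Fin (2 * j) → Ω, ∑ x, ∏ i, (if rs i ∈ bad x then (2 : ℝ) else 1) :=
          Finset.sum_le_sum fun rs _ => h₁ rs
      _ = ∑ x, ((Fintype.card Ω : ℝ) + (bad x).card) ^ (2 * j) := by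
          rw [Finset.sum_comm]
          exact Finset.sum_congr rfl fun x _ => h₂ x
      _ ≤ ∑ _x : X, (4 / 3 * (Fintype.card Ω : ℝ)) ^ (2 * j) := by
          refine Finset.sum_le_sum fun x _ => pow_le_pow_left₀ (by positivity) ?_ _
          have : (3 * (bad x).card : ℝ) ≤ Fintype.card Ω := by exact_mod_cast hbad x
          linarith
      _ = Fintype.card X * (4 / 3 * (Fintype.card Ω : ℝ)) ^ (2 * j) := by simp
      _ ≤ _ := by
          gcongr
          exact_mod_cast hX
  rw [mul_pow, mul_comm ((4 / 3 : ℝ) ^ _), ← mul_assoc, mul_comm (2 ^ n : ℝ), mul_assoc] at h₃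
  have h₄ := le_of_mul_le_mul_left h₃ (by positivity)
  rw [pow_mul] at h₄
  -- `2 = 9 / 8 * (4 / 3) ^ 2`, and `(9 / 8) ^ 6 > 2` explains the factor 6 in `hj`.
  have h₅ : (2 : ℝ) ^ j = (9 / 8) ^ j * ((4 / 3) ^ 2) ^ j := by
    rw [← mul_pow]
    norm_num
  rw [h₅] at h₄
  have h₆ := le_of_mul_le_mul_right h₄ (by positivity)
  have h₇ : (2 : ℝ) ^ (n + 1) ≤ (9 / 8) ^ j := by
    calc (2 : ℝ) ^ (n + 1) ≤ ((9 / 8) ^ 6) ^ (n + 1) :=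
          pow_le_pow_left₀ (by norm_num) (by norm_num) _
      _ = (9 / 8) ^ (6 * (n + 1)) := (pow_mul _ _ _).symm
      _ ≤ (9 / 8) ^ j := pow_le_pow_right₀ (by norm_num) hj
  have : (2 : ℝ) ^ n < 2 ^ (n + 1) := pow_lt_pow_right₀ (by norm_num) (by omega)
  linarith

/-- For each length `n`, a majority vote over `2 * j` suitable random strings decides `L`. -/
theorem exists_majority {L R : Language Bool} {n m j : ℕ} (hj : 6 * (n + 1) ≤ j)
    (h : ∀ x : List Bool, x.length = n → (2 / 3 : ℝ) <
      (Nat.card {r : Fin m → Bool // pair x (List.ofFn r) ∈ R ↔ x ∈ L} : ℝ) / 2 ^ m) :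
    ∃ rs : List (List Bool), rs.length = 2 * j ∧ (∀ r ∈ rs, r.length = m) ∧
      ∀ x : List Bool, x.length = n → ∀ p : List Bool → Bool,
        (∀ r ∈ rs, p r = true ↔ pair x r ∈ R) → (x ∈ L ↔ j ≤ rs.countP p) := by
  classical
  let bad (x : List.Vector Bool n) : Finset (Fin m → Bool) :=
    Finset.univ.filter fun r => ¬ (pair x.1 (List.ofFn r) ∈ R ↔ x.1 ∈ L)
  have hbad : ∀ x, 3 * (bad x).card ≤ Fintype.card (Fin m → Bool) := by
    intro x
    have hx := h x.1 x.2
    rw [Nat.card_eq_fintype_card, Fintype.card_subtype, lt_div_iff₀ (by positivity)] at hx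
    have e := Finset.card_filter_add_card_filter_not (s := (Finset.univ : Finset (Fin m → Bool)))
      (fun r => pair x.1 (List.ofFn r) ∈ R ↔ x.1 ∈ L)
    have hc : Fintype.card (Fin m → Bool) = 2 ^ m := by simp
    rw [Finset.card_univ, hc] at e
    have e' : ((Finset.univ.filter fun r : Fin m → Bool => pair x.1 (List.ofFn r) ∈ R ↔ x.1 ∈ L).card
        : ℝ) + (bad x).card = 2 ^ m := by exact_mod_cast e
    rw [hc]
    have : (3 * (bad x).card : ℝ) ≤ 2 ^ m := by linarith
    exact_mod_cast this
  obtain ⟨rs, hrs⟩ := exists_samples bad hbad (n := n) (j := j) (by simp [card_vector]) hj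
  refine ⟨List.ofFn fun i => List.ofFn (rs i), by simp, fun r hr => ?_, fun x hx p hp => ?_⟩
  · obtain ⟨i, rfl⟩ := List.mem_ofFn.1 hr
    simp
  have hb := hrs ⟨x, hx⟩
  have hcount : (List.ofFn fun i => List.ofFn (rs i)).countP p =
      (Finset.univ.filter fun i => pair x (List.ofFn (rs i)) ∈ R).card := by
    rw [List.countP_congr (q := fun r => decide (pair x r ∈ R)) fun r hr => by simp [hp r hr]]
    rw [List.ofFn_eq_map, List.countP_map, List.countP_eq_length_filter]
    rfl
  rw [hcount]
  have e := Finset.card_filter_add_card_filter_not (s := (Finset.univ : Finset (Fin (2 * j))))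
    (fun i => pair x (List.ofFn (rs i)) ∈ R)
  -- Fewer than `j` of the `2 * j` votes are wrong: more than `j` accept if `x ∈ L`, and fewer than
  -- `j` otherwise.
  simp only [Finset.card_univ, Fintype.card_fin] at e
  by_cases hL : x ∈ L
  · simp only [bad, Finset.mem_filter, Finset.mem_univ, true_and, hL, iff_true] at hb
    simp only [hL, true_iff]
    omega
  · simp only [bad, Finset.mem_filter, Finset.mem_univ, true_and, hL, iff_false, not_not] at hb
    simp only [hL, false_iff]
    omega

/-! ### The nondeterministic majority vote. -/

/-- Process one random string: simulate `p` on the input and this string, and remove a bit from stack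
`4` if `p` accepts. -/
def voteStep (p v₁ v₀ : Prog) : Prog :=
  readField 0 20 5 ;; .push true 20 ;; .push false 20 ;; copyReverse 1 7 6 ;; transfer 7 [20, 20] ;;
    implement (fun i => 2 * i + 20) (answer v₁ v₀) p ;; .branch 20 .skip .skip (.pop 4) ;;
    clearAll (fun i => 2 * i + 20) (stackBound p + 1)

/-- The nondeterministic majority vote. -/
def vote (p v₁ v₀ : Prog) : Prog :=
  readField 0 6 5 ;; transfer 6 [1] ;; readField 0 2 5 ;; readField 0 3 5 ;; readField 0 4 5 ;;
    .loop 0 (voteStep p v₁ v₀) ;; .branch 4 (.push true 0) (.push false 0) (.push false 0)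

/-- The store between two steps of the vote, with `k` votes missing. -/
def voteStore (x : List Bool) (es₁ es₀ : List (List Bool)) (k : ℕ) (rs : List (List Bool)) : Store
  | 0 => pack rs
  | 1 => x
  | 2 => (pack es₁).reverse
  | 3 => (pack es₀).reverse
  | 4 => List.replicate k true
  | _ => []

/-- A bound for the running time of `voteStep`. -/
noncomputable def voteStepTime (p v₁ v₀ : Prog) (t₁ t₀ : ℕ[X]) : ℕ[X] :=
  35 * X + 50 + answerTime v₁ v₀ t₁ t₀ * X + C (stackBound p + 1) * (5 * X + 2)

/-- A bound for the running time of `vote`. -/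
noncomputable def voteTime (p v₁ v₀ : Prog) (t₁ t₀ : ℕ[X]) : ℕ[X] :=
  400 * X + 400 + X * (voteStepTime p v₁ v₀ t₁ t₀ + 1)

section vote

variable {O R : Language Bool} {p v₁ v₀ : Prog} {t t₁ t₀ : ℕ[X]} {es₁ es₀ : List (List Bool)}
  {M B : ℕ} {x : List Bool}

theorem ready_extend_voteStore (x es₁ es₀ k rs) (a : Store) :
    Ready (extend (fun i => 2 * i + 20) a (voteStore x es₁ es₀ k rs)) := by
  constructor
  · intro k h₁ h₂
    rw [extend_apply' _ _ _ (by rintro ⟨i, h : 2 * i + 20 = _⟩; omega)]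
    obtain ⟨k, rfl⟩ := Nat.exists_eq_add_of_le' h₁
    rfl
  · intro i
    rw [extend_apply' _ _ _ (by rintro ⟨i, h : 2 * i + 20 = _⟩; omega)]
    rfl

theorem simulation_yields (H : Setup O v₁ v₀ t₁ t₀ es₁ es₀ M B) (k rs) {a a' : Store} {n : ℕ}
    (h : Runs (answers O) p a n a') (hM : ∀ i, (a i).length + n ≤ M) :
    Yields guesses (implement (fun i => 2 * i + 20) (answer v₁ v₀) p)
      (extend (fun i => 2 * i + 20) a (voteStore x es₁ es₀ k rs))
      ((answerTime v₁ v₀ t₁ t₀).eval B * n)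
      (extend (fun i => 2 * i + 20) a' (voteStore x es₁ es₀ k rs)) := by
  refine h.yields_implement (M := M) injective_even (by simp [answerTime]) ?_ hM
  intro b i j ans hans hb
  have e (l : ℕ) : extend (fun i => 2 * i + 20) b (voteStore x es₁ es₀ k rs) (2 * l + 20) = b l :=
    injective_even.extend_apply b _ l
  have h' (l : ℕ) (hl : l < 20) : extend (fun i => 2 * i + 20) b (voteStore x es₁ es₀ k rs) l =
      voteStore x es₁ es₀ k rs l :=
    extend_apply' _ _ _ (by rintro ⟨i, h : 2 * i + 20 = _⟩; omega)
  refine (answer_yields H (ready_extend_voteStore x es₁ es₀ k rs b) (h' 2 (by simp))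
    (h' 3 (by simp)) j (i := i) (b := ans) (by rwa [e]) (by rwa [e])).congr ?_ le_rfl
  rw [e, update_extend injective_even (j := j)]

/-- Surplus votes are harmless: popping the empty stack 4 does nothing, in accordance with truncated
subtraction. -/
theorem voteStep_yields (H : Setup O v₁ v₀ t₁ t₀ es₁ es₀ M B) (k rs) {r : List Bool} {n : ℕ}
    {a : Store} (h : Runs (answers O) p (initStore (pair x r)) n a)
    (hM : (pair x r).length + n ≤ M) (hB : (pack (r :: rs)).length ≤ B) {b : Bool}
    (hb : b = true ↔ Accepts a) :
    Yields guesses (voteStep p v₁ v₀) (voteStore x es₁ es₀ k (r :: rs))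
      ((voteStepTime p v₁ v₀ t₁ t₀).eval B)
      (voteStore x es₁ es₀ (k - if b = true then 1 else 0) rs) := by
  have hMB := H.le
  have hx : x.length ≤ B := by simp [length_pair] at hM; omega
  have a₁ : Yields guesses (readField 0 20 5) (voteStore x es₁ es₀ k (r :: rs)) (10 * B + 20)
      (update (voteStore x es₁ es₀ k rs) 20 r) := by
    refine (readField_yields (i := 0) (j := 20) (c := 5) (by simp) (by simp) (by simp) _ rfl).congr
      ?_ (by simpa [voteStore] using hB)
    funext k
    match k with
    | 0 => simp [voteStore]
    | 1 => simp [voteStore]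
    | 2 => simp [voteStore]
    | 3 => simp [voteStore]
    | 4 => simp [voteStore]
    | k + 5 =>
      by_cases hk : k = 15
      · subst hk; simp [voteStore]
      · simp [voteStore, hk]
  have a₂ := (Yields.push (A := guesses) true 20 (update (voteStore x es₁ es₀ k rs) 20 r)).congr
    (s₂ := update (voteStore x es₁ es₀ k rs) 20 (true :: r)) (by simp) le_rfl
  have a₃ := (Yields.push (A := guesses) false 20
    (update (voteStore x es₁ es₀ k rs) 20 (true :: r))).congr
    (s₂ := update (voteStore x es₁ es₀ k rs) 20 (false :: true :: r)) (by simp) le_rfl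
  have a₄ := (copyReverse_yields (A := guesses) (i := 1) (j := 7) (t := 6) (by simp) (by simp)
    (by simp) (update (voteStore x es₁ es₀ k rs) 20 (false :: true :: r)) rfl).congr
    (s₂ := update (update (voteStore x es₁ es₀ k rs) 20 (false :: true :: r)) 7 x.reverse)
    (d := 16 * B + 3) (by simp [voteStore]) (by simp [voteStore]; omega)
  have a₅ : Yields guesses (transfer 7 [20, 20])
      (update (update (voteStore x es₁ es₀ k rs) 20 (false :: true :: r)) 7 x.reverse) (9 * B + 1)
      (extend (fun i => 2 * i + 20) (initStore (pair x r)) (voteStore x es₁ es₀ k rs)) := by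
    refine (move_double_yields (i := 7) (j := 20) (by simp) _).congr ?_ (by simp; omega)
    symm
    refine extend_of_forall injective_even (fun i => ?_) fun l hl => ?_
    · by_cases hi : i = 0
      · simp [hi, initStore, pair_eq]
      · rw [update_of_ne (by omega), update_of_ne (by omega), update_of_ne (by omega),
          update_of_ne (by omega), initStore, if_neg hi]
        rfl
    · rw [update_of_ne (fun e => hl 0 e.symm)]
      by_cases h₇ : l = 7
      · subst h₇; simp [voteStore]
      · rw [update_of_ne h₇, update_of_ne h₇, update_of_ne (fun e => hl 0 e.symm)]
  have hle (i : ℕ) : (initStore (pair x r) i).length ≤ (pair x r).length := by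
    unfold initStore
    split_ifs <;> simp
  have a₆ := simulation_yields (x := x) H k rs h fun i => by have := hle i; omega
  have a₇ : Yields guesses (.branch 20 .skip .skip (.pop 4))
      (extend (fun i => 2 * i + 20) a (voteStore x es₁ es₀ k rs)) 2
      (extend (fun i => 2 * i + 20) a
        (voteStore x es₁ es₀ (k - if b = true then 1 else 0) rs)) := by
    have e : extend (fun i => 2 * i + 20) a (voteStore x es₁ es₀ k rs) 20 = a 0 :=
      injective_even.extend_apply a _ 0
    rcases hl : a 0 with _ | ⟨_ | _, l⟩
    · obtain rfl : b = false := by simpa [Accepts, hl] using hb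
      exact (Yields.skip _).branch_nil (by rw [e, hl])
    · obtain rfl : b = false := by simpa [Accepts, hl] using hb
      exact (Yields.skip _).branch_false (by rw [e, hl])
    · obtain rfl : b = true := by simpa [Accepts, hl] using hb
      refine ((Yields.pop 4 _).branch_true (by rw [e, hl])).congr ?_ le_rfl
      symm
      refine extend_of_forall injective_even (fun i => ?_) fun l hl => ?_
      · rw [update_of_ne (by omega)]
        exact injective_even.extend_apply a _ i
      · have h' (l : ℕ) (hl : ∀ i, 2 * i + 20 ≠ l) :
            extend (fun i => 2 * i + 20) a (voteStore x es₁ es₀ k rs) l =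
              voteStore x es₁ es₀ k rs l :=
          extend_apply' _ _ _ (by rintro ⟨i, h⟩; exact hl i h)
        by_cases h₄ : l = 4
        · subst h₄
          rw [update_self, h' 4 hl]
          simp [voteStore]
        · rw [update_of_ne h₄, h' l hl]
          match l with
          | 0 => rfl
          | 1 => rfl
          | 2 => rfl
          | 3 => rfl
          | 4 => exact absurd rfl h₄
          | l + 5 => rfl
  have a₈ := clearAll_yields (A := guesses) injective_even (M := M) (stackBound p + 1) a
    (voteStore x es₁ es₀ (k - if b = true then 1 else 0) rs)
    (fun i => by have := h.length_le i; have := hle i; omega)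
    (fun i hi => by rw [h.eq_of_stackBound_le (by omega), initStore, if_neg (by omega)])
  refine (a₁.seq (a₂.seq (a₃.seq (a₄.seq (a₅.seq (a₆.seq (a₇.seq a₈))))))).congr ?_ ?_
  · exact extend_of_forall injective_even (fun i => rfl) fun _ _ => rfl
  · have e₁ : (answerTime v₁ v₀ t₁ t₀).eval B * n ≤ (answerTime v₁ v₀ t₁ t₀).eval B * B := by
      gcongr
      omega
    have e₂ : (stackBound p + 1) * (5 * M + 2) ≤ (stackBound p + 1) * (5 * B + 2) := by gcongr
    simp [voteStepTime]
    omega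

theorem loop_voteStep_yields (H : Setup O v₁ v₀ t₁ t₀ es₁ es₀ M B)
    (hp : ∀ x : List Bool, ∃ n ≤ t.eval x.length, ∃ s,
      Runs (answers O) p (initStore x) n s ∧ (Accepts s ↔ x ∈ R)) (k : ℕ) (rs : List (List Bool))
    (hM : ∀ r ∈ rs, (pair x r).length + t.eval (pair x r).length ≤ M) (hB : (pack rs).length ≤ B)
    {acc : List Bool → Bool} (hacc : ∀ r ∈ rs, acc r = true ↔ pair x r ∈ R) :
    Yields guesses (.loop 0 (voteStep p v₁ v₀)) (voteStore x es₁ es₀ k rs)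
      (rs.length * ((voteStepTime p v₁ v₀ t₁ t₀).eval B + 1) + 1)
      (voteStore x es₁ es₀ (k - rs.countP acc) []) := by
  induction rs generalizing k with
  | nil => exact (Yields.loop_nil rfl).congr (by simp) (by simp)
  | cons r rs ih =>
    obtain ⟨n, hn, a, ha, haR⟩ := hp (pair x r)
    have hM' := hM r (by simp)
    have step := voteStep_yields H k rs ha (by omega) hB (b := acc r)
      (by rw [haR, hacc r (by simp)])
    refine (step.loop_cons ?_ (ih (k - if acc r = true then 1 else 0)
      (fun r' hr' => hM r' (by simp [hr'])) ?_ (fun r' hr' => hacc r' (by simp [hr'])))).congr ?_ ?_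
    · simp [voteStore, pair_eq]
    · have := length_pack_drop_le (r :: rs) 1
      simp only [List.drop_succ_cons, List.drop_zero] at this
      omega
    · rw [List.countP_cons, Nat.sub_sub, add_comm]
    · simp only [List.length_cons]
      ring_nf
      omega

theorem length_le_length_pack (es : List (List Bool)) : es.length ≤ (pack es).length := by
  induction es with
  | nil => simp
  | cons e es ih => simp [length_pair]; omega

/-- The advice: both tables, the number of votes required, and the random strings. -/
def voteAdvice (es₁ es₀ : List (List Bool)) (j : ℕ) (rs : List (List Bool)) : List Bool :=
  pair (pack es₁) (pair (pack es₀) (pair (List.replicate j true) (pack rs)))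

theorem vote_yields (H : Setup O v₁ v₀ t₁ t₀ es₁ es₀ M B)
    (hp : ∀ x : List Bool, ∃ n ≤ t.eval x.length, ∃ s,
      Runs (answers O) p (initStore x) n s ∧ (Accepts s ↔ x ∈ R)) (j : ℕ) (rs : List (List Bool))
    (hM : ∀ r ∈ rs, (pair x r).length + t.eval (pair x r).length ≤ M) (hB : (pack rs).length ≤ B)
    (hx : x.length ≤ B) (hj : j ≤ B)
    {acc : List Bool → Bool} (hacc : ∀ r ∈ rs, acc r = true ↔ pair x r ∈ R) :
    ∃ s, Yields guesses (vote p v₁ v₀) (initStore (pair x (voteAdvice es₁ es₀ j rs)))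
      ((voteTime p v₁ v₀ t₁ t₀).eval B) s ∧ (Accepts s ↔ j ≤ rs.countP acc) := by
  have hB₁ := H.le₁
  have hB₀ := H.le₀
  have a₁ : Yields guesses (readField 0 6 5) (initStore (pair x (voteAdvice es₁ es₀ j rs)))
      (90 * B + 100) (update (initStore (voteAdvice es₁ es₀ j rs)) 6 x.reverse) := by
    refine (readField_yields (i := 0) (j := 6) (c := 5) (by simp) (by simp) (by simp) _ rfl).congr
      ?_ (by simp [initStore, voteAdvice, length_pair]; omega)
    funext k
    by_cases h0 : k = 0 <;> simp [initStore, h0, update_apply]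
  have a₂ : Yields guesses (transfer 6 [1])
      (update (initStore (voteAdvice es₁ es₀ j rs)) 6 x.reverse) (7 * B + 1)
      (update (initStore (voteAdvice es₁ es₀ j rs)) 1 x) := by
    refine (move_yields (i := 6) (j := 1) (by simp) _).congr ?_ (by simp; omega)
    funext k
    simp only [update_apply, initStore]
    split_ifs <;> simp_all
  have a₃ : Yields guesses (readField 0 2 5) (update (initStore (voteAdvice es₁ es₀ j rs)) 1 x)
      (70 * B + 80) (update (update (initStore (pair (pack es₀) (pair (List.replicate j true)
        (pack rs)))) 1 x) 2 (pack es₁).reverse) := by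
    refine (readField_yields (i := 0) (j := 2) (c := 5) (by simp) (by simp) (by simp) _ rfl).congr
      ?_ (by simp [initStore, voteAdvice, length_pair]; omega)
    funext k
    simp only [update_apply, initStore, voteAdvice]
    split_ifs <;> simp_all
  have a₄ : Yields guesses (readField 0 3 5) (update (update (initStore (pair (pack es₀)
      (pair (List.replicate j true) (pack rs)))) 1 x) 2 (pack es₁).reverse)
      (50 * B + 60) (update (update (update (initStore (pair (List.replicate j true)
        (pack rs))) 1 x) 2 (pack es₁).reverse) 3 (pack es₀).reverse) := by
    refine (readField_yields (i := 0) (j := 3) (c := 5) (by simp) (by simp) (by simp) _ rfl).congr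
      ?_ (by simp [initStore, length_pair]; omega)
    funext k
    simp only [update_apply, initStore]
    split_ifs <;> simp_all
  have a₅ : Yields guesses (readField 0 4 5) (update (update (update (initStore
      (pair (List.replicate j true) (pack rs))) 1 x) 2 (pack es₁).reverse) 3 (pack es₀).reverse)
      (30 * B + 40) (voteStore x es₁ es₀ j rs) := by
    refine (readField_yields (i := 0) (j := 4) (c := 5) (by simp) (by simp) (by simp) _ rfl).congr
      ?_ (by simp [initStore, length_pair]; omega)
    funext k
    match k with
    | 0 => simp [voteStore, initStore]
    | 1 => simp [voteStore, initStore]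
    | 2 => simp [voteStore, initStore]
    | 3 => simp [voteStore, initStore]
    | 4 => simp [voteStore, initStore]
    | k + 5 => simp [voteStore, initStore]
  have a₆ := loop_voteStep_yields H hp j rs hM hB hacc
  have a₇ : ∃ s, Yields guesses (.branch 4 (.push true 0) (.push false 0) (.push false 0))
      (voteStore x es₁ es₀ (j - rs.countP acc) []) 2 s ∧ (Accepts s ↔ j ≤ rs.countP acc) := by
    -- The truncated difference vanishes exactly if at least `j` simulations accepted.
    rcases hk : j - rs.countP acc with _ | k
    · exact ⟨_, (Yields.push true 0 _).branch_nil rfl, by simp [Accepts]; omega⟩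
    · exact ⟨_, (Yields.push false 0 _).branch_true (l := List.replicate k true) rfl,
        by simp [Accepts]; omega⟩
  obtain ⟨s, a₇, hs⟩ := a₇
  refine ⟨s, (a₁.seq (a₂.seq (a₃.seq (a₄.seq (a₅.seq (a₆.seq a₇)))))).mono ?_, hs⟩
  have e : rs.length * ((voteStepTime p v₁ v₀ t₁ t₀).eval B + 1) ≤
      B * ((voteStepTime p v₁ v₀ t₁ t₀).eval B + 1) := by
    gcongr
    exact (length_le_length_pack rs).trans hB
  simp [voteTime]
  omega

end vote

/-! ### Assembling the advice. -/

/-- A language in `NP/poly` has polynomially long table entries for each length. -/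
theorem exists_entries {O : Language Bool} (h : O ∈ withAdvice NP poly) :
    ∃ (v : Prog) (t : ℕ[X]) (R : Language Bool) (f u : ℕ → List Bool) (E : ℕ[X]), Decides v t R ∧
      (∀ n, (pair (f n) (u n)).length ≤ E.eval n) ∧ ∀ y : List Bool, y ∈ O ↔
        ∃ w : List Bool, w.length ≤ (u y.length).length ∧ pair (pair y (f y.length)) w ∈ R := by
  obtain ⟨L, ⟨R, hR, q, hq⟩, f, ⟨g, hg⟩, hf⟩ := h
  obtain ⟨v, t, hv⟩ := exists_runs_of_mem_PRel hR
  -- `u n` is the witness bound in unary, so that no machine has to evaluate `q`; `2 * n + (f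
  -- n).length + 2` is the length of `pair y (f n)` for `y` of length `n`.
  refine ⟨v, t, R, f, fun n => List.replicate (q.eval (2 * n + (f n).length + 2)) true,
    2 * g + q.comp (2 * X + g + 2) + 2, hv, fun n => ?_, fun y => ?_⟩
  · have h₁ := hg n
    have h₂ := eval_le_eval q (show 2 * n + (f n).length + 2 ≤ 2 * n + g.eval n + 2 by omega)
    simp [length_pair]
    omega
  · rw [hf, hq]
    simp [length_pair]

/-- The table of all entries for lengths up to `M`. -/
def table (f u : ℕ → List Bool) (M : ℕ) : List (List Bool) :=
  (List.range (M + 1)).map fun n => pair (f n) (u n)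

theorem certifies_table {R : Language Bool} {f u : ℕ → List Bool} {M : ℕ} {y : List Bool}
    (hy : y.length ≤ M) {T : Prop} (hT : T ↔ ∃ w : List Bool, w.length ≤ (u y.length).length ∧
      pair (pair y (f y.length)) w ∈ R) : Certifies R (table f u M) y T := by
  refine ⟨f y.length, u y.length, (table f u M).drop (y.length + 1), ?_, hT⟩
  rw [List.drop_eq_getElem_cons (by simp [table]; omega)]
  simp [table]

theorem length_pack_le {es : List (List Bool)} {b : ℕ} (h : ∀ e ∈ es, e.length ≤ b) :
    (pack es).length ≤ es.length * (2 * b + 2) := by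
  induction es with
  | nil => simp
  | cons e es ih =>
    have h₁ := ih fun e he => h e (by simp [he])
    have h₂ := h e (by simp)
    simp only [pack_cons, length_pair, List.length_reverse, List.length_cons]
    nlinarith

theorem length_pack_table_le {f u : ℕ → List Bool} {E : ℕ[X]}
    (h : ∀ n, (pair (f n) (u n)).length ≤ E.eval n) (M : ℕ) :
    (pack (table f u M)).length ≤ (M + 1) * (2 * E.eval M + 2) := by
  refine (length_pack_le (b := E.eval M) fun e he => ?_).trans (by simp [table])
  obtain ⟨n, hn, rfl⟩ := List.mem_map.1 he
  exact (h n).trans (eval_le_eval E (by simpa [Nat.lt_succ_iff] using hn))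

theorem mem_coNP_advice_iff {L : Language Bool} :
    L ∈ withAdvice coNP poly ↔ Lᶜ ∈ withAdvice NP poly := by
  constructor
  · rintro ⟨L', h, f, hf, hL⟩
    exact ⟨L'ᶜ, h, f, hf, fun x => not_congr (hL x)⟩
  · rintro ⟨L', h, f, hf, hL⟩
    refine ⟨L'ᶜ, ?_, f, hf, fun x => ?_⟩
    · change L'ᶜᶜ ∈ NP
      rwa [compl_compl]
    · exact not_iff_not.1 ((hL x).trans (not_not (a := pair x (f x.length) ∈ L')).symm)

theorem mem_NP_advice_of_mem_BPPRel {O L : Language Bool} (h₁ : O ∈ withAdvice NP poly)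
    (h₀ : Oᶜ ∈ withAdvice NP poly) (hL : L ∈ BPPRel O) : L ∈ withAdvice NP poly := by
  classical
  obtain ⟨v₁, t₁, R₁, f₁, u₁, E₁, hv₁, hE₁, hO₁⟩ := exists_entries h₁
  obtain ⟨v₀, t₀, R₀, f₀, u₀, E₀, hv₀, hE₀, hO₀⟩ := exists_entries h₀
  obtain ⟨R, hR, m, hm⟩ := hL
  obtain ⟨p, t, hp⟩ := exists_runs_of_mem_PRel hR
  choose rs hlen hmem hmaj using fun n : ℕ =>
    exists_majority (L := L) (R := R) (n := n) (m := m.eval n) (j := 6 * (n + 1)) le_rfl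
      (by rintro x rfl; exact hm x)
  -- `ℓ` is the length of the input together with a random string, `M` adds the running time and so
  -- bounds all queries, and `B` bounds every part of the advice.
  let ℓ : ℕ[X] := 2 * X + m + 2
  let M : ℕ[X] := ℓ + t.comp ℓ
  let B : ℕ[X] := M + (M + 1) * (2 * E₁.comp M + 2) + (M + 1) * (2 * E₀.comp M + 2) +
    12 * (X + 1) * (2 * m + 2) + 6 * (X + 1)
  let es₁ (n : ℕ) := table f₁ u₁ (M.eval n)
  let es₀ (n : ℕ) := table f₀ u₀ (M.eval n)
  let a (n : ℕ) : List Bool := voteAdvice (es₁ n) (es₀ n) (6 * (n + 1)) (rs n)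
  have hM (n : ℕ) : M.eval n = 2 * n + m.eval n + 2 + t.eval (2 * n + m.eval n + 2) := by
    simp [M, ℓ]
  have hB (n : ℕ) : B.eval n = M.eval n + (M.eval n + 1) * (2 * E₁.eval (M.eval n) + 2) +
      (M.eval n + 1) * (2 * E₀.eval (M.eval n) + 2) + 12 * (n + 1) * (2 * m.eval n + 2) +
      6 * (n + 1) := by
    simp [B]
  have hpack₁ (n : ℕ) := length_pack_table_le hE₁ (M.eval n)
  have hpack₀ (n : ℕ) := length_pack_table_le hE₀ (M.eval n)
  have hrs (n : ℕ) : (pack (rs n)).length ≤ 12 * (n + 1) * (2 * m.eval n + 2) := by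
    refine (length_pack_le (b := m.eval n) fun r hr => (hmem n r hr).le).trans ?_
    rw [hlen, ← mul_assoc 2 6]
    exact le_rfl
  have setup (n : ℕ) : Setup O v₁ v₀ t₁ t₀ (es₁ n) (es₀ n) (M.eval n) (B.eval n) := by
    refine ⟨⟨R₁, R₀, hv₁, hv₀, fun y hy => ⟨certifies_table hy (hO₁ y), certifies_table hy
      (hO₀ y)⟩⟩, ?_, ?_, ?_⟩
    · rw [hB]; omega
    · rw [hB]; exact (hpack₁ n).trans (by omega)
    · rw [hB]; exact (hpack₀ n).trans (by omega)
  have key (x : List Bool) : ∃ s, Yields guesses (vote p v₁ v₀) (initStore (pair x (a x.length)))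
      (((voteTime p v₁ v₀ t₁ t₀).comp B).eval x.length) s ∧ (Accepts s ↔ x ∈ L) := by
    have g₁ : ∀ r ∈ rs x.length, (pair x r).length + t.eval (pair x r).length ≤ M.eval x.length := by
      intro r hr
      rw [length_pair, hmem _ r hr, hM]
    have g₂ : (pack (rs x.length)).length ≤ B.eval x.length := by
      rw [hB]; exact (hrs _).trans (by omega)
    obtain ⟨s, hs, ha⟩ := vote_yields (x := x) (setup x.length) hp (6 * (x.length + 1))
      (rs x.length) g₁ g₂ (by rw [hB, hM]; omega) (by rw [hB]; omega)
      (acc := fun r => decide (pair x r ∈ R)) (fun r _ => by simp)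
    refine ⟨s, by simpa using hs, ?_⟩
    rw [ha, hmaj x.length x rfl _ fun r _ => decide_eq_true_iff]
  obtain ⟨L', hL', hsound, hcomplete⟩ := exists_mem_NP_of_prog (vote p v₁ v₀)
    ((voteTime p v₁ v₀ t₁ t₀).comp B)
  -- Three nested pairs double three components of length at most `B`, the fourth stays single, and
  -- 6 separator bits are added.
  refine ⟨L', hL', a, ⟨7 * B + 6, fun n => ?_⟩, fun x => ?_⟩
  · have h₂ := (setup n).le₁
    have h₃ := (setup n).le₀
    have h₄ := hrs n
    have h₅ := hB n
    simp [a, voteAdvice, length_pair]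
    omega
  · obtain ⟨s, hs, ha⟩ := key x
    rw [← ha]
    constructor
    · intro hacc
      obtain ⟨n, hn, hr⟩ := hs.1
      -- The time bound is a polynomial in the length of `x`, which is at most that of the pair with
      -- the advice.
      refine hcomplete _ n s hr hacc (hn.trans (eval_le_eval _ ?_))
      rw [length_pair]; omega
    · intro hz
      -- An accepting run of any length suffices, since its outcome has to be `s`.
      obtain ⟨n, s', hr, hacc⟩ := hsound _ hz
      rwa [hs.2 _ _ hr] at hacc

end OracleComplexity

theorem mainTheorem8 :
    OracleComplexity.BPPRelClass
        (OracleComplexity.withAdvice OracleComplexity.NP OracleComplexity.poly ∩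
          OracleComplexity.withAdvice OracleComplexity.coNP OracleComplexity.poly) =
      OracleComplexity.withAdvice OracleComplexity.NP OracleComplexity.poly ∩
        OracleComplexity.withAdvice OracleComplexity.coNP OracleComplexity.poly := by
  ext L
  constructor
  · rintro ⟨O, ⟨h₁, h₀⟩, hL⟩
    have h₀' := OracleComplexity.mem_coNP_advice_iff.1 h₀
    exact ⟨OracleComplexity.mem_NP_advice_of_mem_BPPRel h₁ h₀' hL,
      OracleComplexity.mem_coNP_advice_iff.2 (OracleComplexity.mem_NP_advice_of_mem_BPPRel h₁ h₀'
        (OracleComplexity.compl_mem_BPPRel hL))⟩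
  · exact fun h => ⟨L, h, OracleComplexity.mem_BPPRel_self L⟩
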